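/- Setting (one time bin; all quantities refer to this bin). There are $m$ storage nodes and $r$ files. File $i$ is coded with an $(n_i,k_i)$ MDS code and its $n_i\ge k_i$ chunks are stored on a set $\mathcal S_i$ of $n_i$ distinct nodes; $d_i\le k_i$ further functional chunks of file $i$ are kept in the cache. File requests form a Poisson process in which requests for file $i$ have rate $\lambda_i\ge 0$. Under probabilistic scheduling each request for file $i$ is sent, independently of everything else, to a random set $\mathcal A_i\subseteq\mathcal S_i$ of exactly $k_i-d_i$ nodes drawn from a fixed law $\mathbb P(\mathcal A_i)$; let $\pi_{ij}=\mathbb P(j\in\mathcal A_i)$. Each node is a single-server FIFO queue of infinite capacity. The service times $X_j\ge 0$ at node $j$ are i.i.d. over requests and independent of the arrivals and of the dispatch decisions, with $\mathbb E[X_j]=1/\mu_j>0$, variance $\sigma_j^2$, second moment $\Gamma_j^2$ and finite third moment $\hat\Gamma_j^3$. Let $\Lambda_j=\sum_{i=1}^r\lambda_i\pi_{ij}$ and $\rho_j=\Lambda_j/\mu_j$, and assume $\rho_j<1$ for every $j$. In steady state let $Q_j$ be the time (queueing plus service) that a chunk request spends at node $j$, and let $\bar T_i=\mathbb E\big[\max_{j\in\mathcal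 A_i}Q_j\big]$ be the mean latency of a request for file $i$. For a finite family of means $e_j$ and variances $v_j$ put $$U_i(e,v)=\inf_{z\in\mathbb R}\Big\{z+\sum_{j\in\mathcal S_i}\frac{\pi_{ij}}2(e_j-z)+\sum_{j\in\mathcal S_i}\frac{\pi_{ij}}2\sqrt{(e_j-z)^2+v_j}\Big\}.$$ Lemma 1. Let $i$ be a file with $\lambda_i>0$ and $d_i<k_i$. In steady state every $Q_j$ has a finite second moment, with $$\mathbb E[Q_j]=\frac1{\mu_j}+\frac{\Lambda_j\Gamma_j^2}{2(1-\rho_j)},\qquad \mathrm{Var}[Q_j]=\sigma_j^2+\frac{\Lambda_j\hat\Gamma_j^3}{3(1-\rho_j)}+\frac{\Lambda_j^2\Gamma_j^4}{4(1-\rho_j)^2},$$ where $\Gamma_j^4=(\Gamma_j^2)^2$, and, with $e^*_j$ and $v^*_j$ denoting these two expressions, the mean latency is finite and $$\bar T_i\le \bar U_i:=U_i(e^*,v^*).$$ The infimum $\bar U_i$ is finite, and it is a minimum if $k_i-d_i\ge 2$. The bound is tight in the following senses. (a) For the given dispatch law and every node $l\in\mathcal S_i$ there is a law of a vector $(Q_j)_j$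 of nonnegative, square-integrable random variables, independent of $\mathcal A_i$, with $\mathbb E[Q_l]=e^*_l$ and $\mathrm{Var}[Q_l]=v^*_l$, for which $\mathbb E[\max_{j\in\mathcal A_i}Q_j]=U_i\big((\mathbb E[Q_j])_j,(\mathrm{Var}[Q_j])_j\big)$. (b) There is a joint law of a random set $\mathcal A\subseteq\mathcal S_i$ with $|\mathcal A|=k_i-d_i$ and $\mathbb P(j\in\mathcal A)=\pi_{ij}$ for all $j$, and of real random variables $Q_j$, each $Q_j$ being independent of the event $\{j\in\mathcal A\}$, with $\mathbb E[Q_j]=e^*_j$ and $\mathrm{Var}[Q_j]=v^*_j$ for all $j$, for which $\mathbb E[\max_{j\in\mathcal A}Q_j]=\bar U_i$. -/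

import Mathlib

open MeasureTheory ProbabilityTheory

noncomputable section

/-- An erasure-coded storage system with `r` files, `m` storage nodes, a cache and a probabilistic
scheduler, within one time bin (all rates are constant). -/
structure StorageSystem (r m : ℕ) where
  /-- nodes storing the coded chunks of a file, one chunk on each node -/
  placement : Fin r → Finset (Fin m)
  /-- number of chunks needed to rebuild a file -/
  k : Fin r → ℕ
  /-- number of functional chunks of a file held in the cache -/
  d : Fin r → ℕ
  k_le_card : ∀ i, k i ≤ (placement i).card
  d_le_k : ∀ i, d i ≤ k i
  /-- Poisson arrival rate of the requests for a file -/
  rate : Fin r → ℝ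
  rate_nonneg : ∀ i, 0 ≤ rate i
  /-- law of the set of nodes to which a request for a file is sent -/
  dispatch : Fin r → PMF (Finset (Fin m))
  dispatch_subset : ∀ i, ∀ A ∈ (dispatch i).support, A ⊆ placement i
  dispatch_card : ∀ i, ∀ A ∈ (dispatch i).support, A.card = k i - d i
  /-- joint law of the chunk service times `(X_j)_j` at the nodes for one request; the dependence
  between different nodes is arbitrary, only the marginals enter the results -/
  service : Measure (Fin m → ℝ)
  service_prob : IsProbabilityMeasure service
  service_nonneg : ∀ j, ∀ᵐ x ∂service, 0 ≤ x j
  service_memLp : ∀ j, MemLp (fun x => x j) 3 service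
  service_mean_pos : ∀ j, 0 < ∫ x, x j ∂service

namespace StorageSystem

variable {r m : ℕ} (sys : StorageSystem r m)

/-- `π i j`: probability that a request for file `i` is sent to node `j`. -/
def selProb (i : Fin r) (j : Fin m) : ℝ :=
  ∑ A : Finset (Fin m), if j ∈ A then (sys.dispatch i A).toReal else 0

/-- Service rate `μ j = 1 / E[X_j]`. -/
def serviceRate (j : Fin m) : ℝ := (∫ x, x j ∂sys.service)⁻¹

/-- Variance `σ_j ^ 2` of the service time. -/
def serviceVar (j : Fin m) : ℝ := variance (fun x => x j) sys.service

/-- Second moment `Γ_j ^ 2 = E[X_j ^ 2]` of the service time. -/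
def serviceMom2 (j : Fin m) : ℝ := ∫ x, x j ^ 2 ∂sys.service

/-- Third moment `E[X_j ^ 3]` of the service time. -/
def serviceMom3 (j : Fin m) : ℝ := ∫ x, x j ^ 3 ∂sys.service

/-- Arrival rate `Λ_j = ∑ i, λ_i π_ij` of chunk requests at node `j`. -/
def nodeRate (j : Fin m) : ℝ := ∑ i, sys.rate i * sys.selProb i j

/-- Request intensity `ρ_j = Λ_j / μ_j`. -/
def intensity (j : Fin m) : ℝ := sys.nodeRate j / sys.serviceRate j

/-- The formula for the mean of `Q_j`. -/
def delayMean (j : Fin m) : ℝ :=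
  1 / sys.serviceRate j + sys.nodeRate j * sys.serviceMom2 j / (2 * (1 - sys.intensity j))

/-- The formula for the variance of `Q_j`. -/
def delayVar (j : Fin m) : ℝ :=
  sys.serviceVar j + sys.nodeRate j * sys.serviceMom3 j / (3 * (1 - sys.intensity j))
    + sys.nodeRate j ^ 2 * sys.serviceMom2 j ^ 2 / (4 * (1 - sys.intensity j) ^ 2)

/-- Total rate of file requests. -/
def totalRate : ℝ := ∑ i, sys.rate i

/-- Law of the pair (requested file, selected nodes) of one file request. -/
def markLaw : Measure (Fin r × Finset (Fin m)) :=
  ∑ i, ∑ A, (ENNReal.ofReal (sys.rate i / sys.totalRate) * sys.dispatch i A) •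
    Measure.dirac (i, A)

/-- Law of the data attached to one file request: time until the next request, (requested file,
selected nodes), service times. The three components are independent. -/
def requestLaw : Measure (ℝ × (Fin r × Finset (Fin m)) × (Fin m → ℝ)) :=
  (expMeasure sys.totalRate).prod (sys.markLaw.prod sys.service)

/-- The system in steady state, observed at the successive file requests `n = 0, 1, 2, …`. File
requests form a Poisson process of rate `∑ i, λ_i` in which a request is for file `i` with
probability `λ_i / ∑ i, λ_i` (so the requests for the various files are independent Poisson
processes of rates `λ_i`). Every node is a single-server FIFO queue of infinite capacity:
`load n j` is the work left at node `j` just before request `n` arrives. -/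
structure SteadyState {Ω : Type*} [MeasurableSpace Ω] (P : Measure Ω) where
  /-- time between request `n` and request `n + 1` -/
  gap : ℕ → Ω → ℝ
  /-- file asked for by request `n` -/
  file : ℕ → Ω → Fin r
  /-- nodes to which request `n` is sent -/
  nodes : ℕ → Ω → Finset (Fin m)
  /-- service time of a chunk of request `n` at each node -/
  work : ℕ → Ω → Fin m → ℝ
  /-- unfinished work at each node just before request `n` arrives -/
  load : ℕ → Ω → Fin m → ℝ
  measurable_gap : ∀ n, Measurable (gap n)
  measurable_file : ∀ n, Measurable (file n)
  measurable_nodes : ∀ n, Measurable (nodes n)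
  measurable_work : ∀ n, Measurable (work n)
  measurable_load : ∀ n, Measurable (load n)
  request_law : ∀ n,
    P.map (fun ω => (gap n ω, (file n ω, nodes n ω), work n ω)) = sys.requestLaw
  /-- each request is independent of the initial load and of all earlier requests -/
  request_indep : ∀ n,
    IndepFun (fun ω => (gap n ω, (file n ω, nodes n ω), work n ω))
      (fun ω => (load 0 ω,
        fun l : Fin n => (gap l ω, (file l ω, nodes l ω), work l ω))) P
  /-- chunk requests join the queues of the selected nodes, which work at unit speed -/
  load_succ : ∀ n ω j,
    load (n + 1) ω j = max (load n ω j + (if j ∈ nodes n ω then work n ω j else 0) - gap n ω) 0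
  /-- stationarity of the vector of loads -/
  stationary : ∀ n, P.map (load n) = P.map (load 0)

/-- `Q_j`: time that a chunk request issued by file request `n` spends at node `j`, queueing and
service included. -/
def SteadyState.delay {sys : StorageSystem r m} {Ω : Type*} [MeasurableSpace Ω] {P : Measure Ω}
    (st : sys.SteadyState P) (n : ℕ) (ω : Ω) (j : Fin m) : ℝ :=
  st.load n ω j + st.work n ω j

end StorageSystem

/-- `max_{j ∈ A} q_j`; zero if `A` is empty (the whole file comes from the cache). -/
def maxDelay {m : ℕ} (A : Finset (Fin m)) (q : Fin m → ℝ) : ℝ :=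
  if h : A.Nonempty then A.sup' h q else 0

/-- Latency of file request `n`: the largest delay at the selected nodes. -/
def StorageSystem.SteadyState.latency {r m : ℕ} {sys : StorageSystem r m} {Ω : Type*}
    [MeasurableSpace Ω] {P : Measure Ω} (st : sys.SteadyState P) (n : ℕ) (ω : Ω) : ℝ :=
  maxDelay (st.nodes n ω) (st.delay n ω)

/-- The function of `z` minimised in the latency bound, for selection probabilities `π`, means `e`
and variances `v`. -/
def boundObjective {m : ℕ} (S : Finset (Fin m)) (π e v : Fin m → ℝ) (z : ℝ) : ℝ :=
  z + ∑ j ∈ S, π j / 2 * (e j - z) + ∑ j ∈ S, π j / 2 * Real.sqrt ((e j - z) ^ 2 + v j)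

/-- The latency bound: the infimum over real `z`. -/
def latencyBound {m : ℕ} (S : Finset (Fin m)) (π e v : Fin m → ℝ) : ℝ :=
  ⨅ z : ℝ, boundObjective S π e v z

end

/-!
Why the theorem is true.

*Moments of the delays.* The loads met by request `n` are a function of the initial loads and of the
earlier requests, hence independent of request `n`. Node by node this is a Lindley recursion
`W' = max (W + B - T) 0` with `W`, `B`, `T` independent, `T` exponential of rate `lam`, and `W'`
distributed like `W`. For `g(y) = min(y, M) ^ p` with `p ≥ 2`, averaging `g + g' / lam` over
`max (y - T) 0` returns `g(y)`, so stationarity gives the rate conservation law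
`E g'(W) = lam * E (g(W + B) - g(W))` with all expectations finite
(`rate_conservation_cappedPow`). With `lam * E B < 1` this bounds the truncated moments uniformly in
`M`, and `M → ∞` gives the Pollaczek-Khinchine formulas (`workload_moments`); `p = 2` gives the mean
and `p = 3` the second moment. The work `B` is the service time times the indicator that the node is
selected, and the delay is `W` plus an independent service time
(`StorageSystem.SteadyState.delay_moments`).

*The bound.* For every `z` the largest selected delay is at most `z + ∑ (Q_j - z)⁺`, the sum being
over the selected nodes, and `E (Q_j - z)⁺` is at most
`((e_j - z) + √((e_j - z) ^ 2 + v_j)) / 2` by Cauchy-Schwarz (`integral_maxDelay_le`). Only the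
independence of `Q_j` from the selection of node `j` is used. For the latency, this is applied under
the law conditioned on the requested file, which does not affect the delays.

*Tightness.* At a given `z`, equality holds if every `Q_j` is at a constant distance `c_j` from `z`,
at most one selected delay lies above `z` and the largest one does not lie below `z`. If a single
node is selected, the infimum is approached as `z → -∞` and equals the mean delay at the selected
node, so every law independent of the dispatch decision attains it. If at least two nodes are
selected and the dispatch law is given, a two-point delay on `{0, 2 z}` at one node and delays `z`
elsewhere do it (`StorageSystem.exists_delayLaw_eq`). If the law of the selected set is free, `z` is
taken to be a minimiser. With `p_j` the probability that `Q_j = z + c_j`, the first-order condition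
reads `∑ π_j p_j = 1`, so that the events "`j` is selected and `Q_j` is high" can be made a
partition. A random set with inclusion probabilities `π_j` and a marked element of law `π_j p_j`
exists by Birkhoff's theorem (`exists_marked_selection`); the marked node gets the high value, the
other selected nodes the low value (`StorageSystem.exists_jointLaw_eq`).
-/

/-! ### Smoothing a test function by an exponential time -/

/-- The test function `g(y) = min(y, M) ^ (q + 1)` plus `1 / lam` times its left derivative. -/
noncomputable def cappedTest (lam M : ℝ) (q : ℕ) (u : ℝ) : ℝ :=
  min u M ^ (q + 1) + ((q : ℝ) + 1) / lam * (if u ≤ M then u ^ q else 0)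

lemma measurable_cappedTest (lam M : ℝ) (q : ℕ) : Measurable (cappedTest lam M q) := by
  unfold cappedTest
  refine ((measurable_id.min measurable_const).pow_const _).add (Measurable.const_mul ?_ _)
  exact Measurable.ite measurableSet_Iic (by fun_prop) measurable_const

lemma abs_cappedTest_le {lam M : ℝ} (hlam : 0 < lam) (hM : 0 < M) (q : ℕ) {u : ℝ} (hu : 0 ≤ u) :
    |cappedTest lam M q u| ≤ M ^ (q + 1) + ((q : ℝ) + 1) / lam * M ^ q := by
  have h0 : 0 ≤ min u M := le_min hu hM.le
  have h1 : min u M ^ (q + 1) ≤ M ^ (q + 1) := pow_le_pow_left₀ h0 (min_le_right _ _) _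
  have h2 : (if u ≤ M then u ^ q else 0) ≤ M ^ q := by
    split_ifs with h
    · exact pow_le_pow_left₀ hu h _
    · positivity
  have h3 : 0 ≤ (if u ≤ M then u ^ q else 0) := by split_ifs <;> positivity
  have h4 : 0 ≤ ((q : ℝ) + 1) / lam := by positivity
  unfold cappedTest
  rw [abs_of_nonneg (by positivity)]
  gcongr

lemma integral_expMeasure {lam : ℝ} (hlam : 0 < lam) (f : ℝ → ℝ) :
    ∫ t, f t ∂(expMeasure lam) = ∫ t in Set.Ioi 0, lam * Real.exp (-(lam * t)) * f t := by
  have h1 : expMeasure lam = volume.withDensity (exponentialPDF lam) := rfl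
  have h2 : Measurable (exponentialPDF lam) :=
    (measurable_exponentialPDFReal lam).ennreal_ofReal
  rw [h1, integral_withDensity_eq_integral_toReal_smul h2
    (Filter.Eventually.of_forall fun _ => ENNReal.ofReal_lt_top), ← integral_Ici_eq_integral_Ioi,
    ← integral_indicator measurableSet_Ici]
  congr 1
  ext t
  by_cases ht : 0 ≤ t
  · rw [Set.indicator_of_mem (by exact ht), exponentialPDF_of_nonneg ht,
      ENNReal.toReal_ofReal (by positivity), smul_eq_mul]
  · rw [Set.indicator_of_notMem (by exact ht), exponentialPDF_of_neg (not_le.1 ht)]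
    simp

/-- Averaging `cappedTest` over one exponential interarrival time gives back the capped power. -/
lemma integral_cappedTest_max_sub {lam M : ℝ} (hlam : 0 < lam) (hM : 0 < M) {q : ℕ} (hq : q ≠ 0)
    {y : ℝ} (hy : 0 ≤ y) :
    ∫ t, cappedTest lam M q (max (y - t) 0) ∂(expMeasure lam) = min y M ^ (q + 1) := by
  have hzero : cappedTest lam M q 0 = 0 := by simp [cappedTest, hM.le, hq]
  -- antiderivative in `t`; the left derivative of the capped power becomes a right derivative here
  set F : ℝ → ℝ := fun t => -(Real.exp (-(lam * t)) * min (y - t) M ^ (q + 1)) with hF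
  set F' : ℝ → ℝ := fun t => lam * Real.exp (-(lam * t)) * cappedTest lam M q (max (y - t) 0)
    with hF'
  have hmeas : Measurable F' :=
    (by fun_prop : Measurable fun t : ℝ => lam * Real.exp (-(lam * t))).mul
      ((measurable_cappedTest lam M q).comp (by fun_prop))
  rw [integral_expMeasure hlam]
  have hsplit : ∫ t in Set.Ioi 0, F' t = ∫ t in Set.Ioc 0 y, F' t := by
    refine (setIntegral_eq_of_subset_of_forall_sdiff_eq_zero measurableSet_Ioi
      Set.Ioc_subset_Ioi_self fun t ht => ?_)
    have : y ≤ t := by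
      by_contra hc
      exact ht.2 ⟨ht.1, (not_le.1 hc).le⟩
    simp only [hF', max_eq_right (sub_nonpos.2 this), hzero, mul_zero]
  rw [show (∫ t in Set.Ioi 0, lam * Real.exp (-(lam * t)) * cappedTest lam M q (max (y - t) 0))
    = ∫ t in Set.Ioi 0, F' t from rfl, hsplit, ← intervalIntegral.integral_of_le hy]
  have hint : IntervalIntegrable F' volume 0 y := by
    rw [intervalIntegrable_iff_integrableOn_Ioc_of_le hy]
    refine Measure.integrableOn_of_bounded
      (M := lam * (M ^ (q + 1) + ((q : ℝ) + 1) / lam * M ^ q)) (by simp)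
      hmeas.aestronglyMeasurable ?_
    refine (ae_restrict_iff' measurableSet_Ioc).2 (Filter.Eventually.of_forall fun t ht => ?_)
    have h1 : Real.exp (-(lam * t)) ≤ 1 := Real.exp_le_one_iff.2 (by nlinarith [ht.1])
    have h2 := abs_cappedTest_le hlam hM q (le_max_right (y - t) 0)
    rw [Real.norm_eq_abs, hF', abs_mul, abs_of_pos (by positivity)]
    refine mul_le_mul ?_ h2 (abs_nonneg _) hlam.le
    nlinarith
  rw [intervalIntegral.integral_eq_sub_of_hasDeriv_right (f := F) (by fun_prop) ?_ hint]
  · simp [hF, hM.le]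
  · intro t ht
    rw [min_eq_left hy, max_eq_right hy] at ht
    have hE : HasDerivAt (fun t => Real.exp (-(lam * t))) (-lam * Real.exp (-(lam * t))) t := by
      have := ((hasDerivAt_id t).const_mul lam).neg.exp
      simpa [mul_comm] using this
    have hyt : 0 ≤ y - t := by linarith [ht.2]
    by_cases hc : y - t ≤ M
    · have h1 : HasDerivAt (fun t => -(Real.exp (-(lam * t)) * (y - t) ^ (q + 1))) (F' t) t := by
        have h2 : HasDerivAt (fun t => (y - t) ^ (q + 1))
            (((q : ℝ) + 1) * (y - t) ^ q * (-1)) t := by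
          have := ((hasDerivAt_id t).const_sub y).fun_pow (q + 1)
          simpa using this
        refine ((hE.mul h2).neg).congr_deriv ?_
        simp only [hF', cappedTest, max_eq_left hyt, min_eq_left hc, if_pos hc]
        field_simp
        ring
      refine h1.hasDerivWithinAt.congr (fun s hs => ?_) ?_
      · have : y - s ≤ M := by linarith [Set.mem_Ioi.1 hs]
        simp only [hF, min_eq_left this]
      · simp only [hF, min_eq_left hc]
    · have hc := not_le.1 hc
      have h1 : HasDerivAt (fun t => -(Real.exp (-(lam * t)) * M ^ (q + 1))) (F' t) t := by
        refine ((hE.mul_const _).neg).congr_deriv ?_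
        simp only [hF', cappedTest, max_eq_left hyt, min_eq_right hc.le, if_neg (not_le.2 hc)]
        ring
      refine HasDerivAt.hasDerivWithinAt (h1.congr_of_eventuallyEq ?_)
      have : ∀ᶠ s in nhds t, M < y - s := by
        have : ContinuousAt (fun s => y - s) t := by fun_prop
        exact this.eventually (lt_mem_nhds hc)
      filter_upwards [this] with s hs
      simp only [hF, min_eq_right hs.le]

/-! ### Moments of a stationary workload -/

section Queue

variable {Ω : Type*} [MeasurableSpace Ω] {P : Measure Ω} [IsProbabilityMeasure P]
  {W B T : Ω → ℝ} {lam : ℝ}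

lemma integrable_cappedPow {X : Ω → ℝ} (mX : Measurable X) (X0 : ∀ᵐ ω ∂P, 0 ≤ X ω) {M : ℝ}
    (hM : 0 < M) (p : ℕ) : Integrable (fun ω => min (X ω) M ^ p) P := by
  refine Integrable.of_bound ((mX.min measurable_const).pow_const p).aestronglyMeasurable (M ^ p) ?_
  filter_upwards [X0] with ω h
  have h0 : 0 ≤ min (X ω) M := le_min h hM.le
  rw [Real.norm_eq_abs, abs_of_nonneg (by positivity)]
  exact pow_le_pow_left₀ h0 (min_le_right _ _) _

lemma integrableOn_pow_le {X : Ω → ℝ} (mX : Measurable X) (X0 : ∀ᵐ ω ∂P, 0 ≤ X ω) (M : ℝ)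
    (q : ℕ) : IntegrableOn (fun ω => X ω ^ q) {ω | X ω ≤ M} P := by
  have hs : MeasurableSet {ω | X ω ≤ M} := measurableSet_le mX measurable_const
  refine Measure.integrableOn_of_bounded (M := M ^ q) (measure_ne_top _ _)
    (mX.pow_const q).aestronglyMeasurable ?_
  rw [ae_restrict_iff' hs]
  filter_upwards [X0] with ω h hω
  rw [Real.norm_eq_abs, abs_of_nonneg (by positivity)]
  exact pow_le_pow_left₀ h hω _

/-- Rate conservation for a stationary workload: in equilibrium the capped power
`min(W, M) ^ (q + 1)` loses by continuous service exactly what it gains at the arrival epochs. -/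
lemma rate_conservation_cappedPow (hlam : 0 < lam) (mW : Measurable W) (mB : Measurable B)
    (mT : Measurable T) (W0 : ∀ᵐ ω ∂P, 0 ≤ W ω) (B0 : ∀ᵐ ω ∂P, 0 ≤ B ω)
    (hT : P.map T = expMeasure lam) (hind : IndepFun (fun ω => (W ω, B ω)) T P)
    (hstat : P.map (fun ω => max (W ω + B ω - T ω) 0) = P.map W)
    {M : ℝ} (hM : 0 < M) {q : ℕ} (hq : q ≠ 0) :
    ((q : ℝ) + 1) * ∫ ω in {ω | W ω ≤ M}, W ω ^ q ∂P =
      lam * ∫ ω, (min (W ω + B ω) M ^ (q + 1) - min (W ω) M ^ (q + 1)) ∂P := by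
  have := isProbabilityMeasure_expMeasure hlam
  have hs : MeasurableSet {ω | W ω ≤ M} := measurableSet_le mW measurable_const
  have mf := measurable_cappedTest lam M q
  have mWB : Measurable fun ω => (W ω, B ω) := mW.prodMk mB
  have : IsProbabilityMeasure (P.map fun ω => (W ω, B ω)) :=
    Measure.isProbabilityMeasure_map mWB.aemeasurable
  have WB0 : ∀ᵐ ω ∂P, 0 ≤ W ω + B ω := by filter_upwards [W0, B0] with ω h1 h2; linarith
  have e1 : ∫ ω, cappedTest lam M q (W ω) ∂P =
      ∫ ω, cappedTest lam M q (max (W ω + B ω - T ω) 0) ∂P := by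
    rw [← integral_map mW.aemeasurable mf.aestronglyMeasurable, ← hstat,
      integral_map (by fun_prop) mf.aestronglyMeasurable]
  have e2 : ∫ ω, cappedTest lam M q (max (W ω + B ω - T ω) 0) ∂P =
      ∫ ω, min (W ω + B ω) M ^ (q + 1) ∂P := by
    have hmap := (indepFun_iff_map_prod_eq_prod_map_map mWB.aemeasurable mT.aemeasurable).1 hind
    have mG : Measurable fun p : (ℝ × ℝ) × ℝ =>
        cappedTest lam M q (max (p.1.1 + p.1.2 - p.2) 0) := mf.comp (by fun_prop)
    have := integral_map (μ := P) (mWB.prodMk mT).aemeasurable mG.aestronglyMeasurable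
    rw [← this, hmap, hT, integral_prod]
    · rw [integral_map mWB.aemeasurable
        mG.stronglyMeasurable.integral_prod_right.aestronglyMeasurable]
      refine integral_congr_ae ?_
      filter_upwards [WB0] with ω h
      exact integral_cappedTest_max_sub hlam hM hq h
    · exact Integrable.of_bound mG.aestronglyMeasurable _ (Filter.Eventually.of_forall fun p =>
        abs_cappedTest_le hlam hM q (le_max_right _ _))
  have e3 : ∫ ω, cappedTest lam M q (W ω) ∂P =
      ∫ ω, min (W ω) M ^ (q + 1) ∂P
        + ((q : ℝ) + 1) / lam * ∫ ω in {ω | W ω ≤ M}, W ω ^ q ∂P := by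
    have hi := (integrable_indicator_iff hs).2 (integrableOn_pow_le (P := P) mW W0 M q)
    rw [← integral_indicator hs, ← integral_const_mul, ← integral_add
      (integrable_cappedPow mW W0 hM _) (hi.const_mul _)]
    refine integral_congr_ae (Filter.Eventually.of_forall fun ω => ?_)
    simp [cappedTest, Set.indicator_apply]
  rw [integral_sub (integrable_cappedPow (X := fun ω => W ω + B ω) (mW.add mB) WB0 hM _)
    (integrable_cappedPow mW W0 hM _), ← e2, ← e1, e3]
  field_simp
  ring

/-- One step of the Pollaczek-Khinchine recursion for the moments of a stationary workload. The
truncated identity bounds the truncated moment, which gives integrability; removing the truncation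
gives the moment. -/
lemma integrable_pow_workload (hlam : 0 < lam) (mW : Measurable W) (mB : Measurable B)
    (mT : Measurable T) (W0 : ∀ᵐ ω ∂P, 0 ≤ W ω) (B0 : ∀ᵐ ω ∂P, 0 ≤ B ω)
    (hT : P.map T = expMeasure lam) (hind : IndepFun (fun ω => (W ω, B ω)) T P)
    (hWB : IndepFun W B P)
    (hstat : P.map (fun ω => max (W ω + B ω - T ω) 0) = P.map W)
    (hB : Integrable B P) (hrho : lam * ∫ ω, B ω ∂P < 1) {q : ℕ} (hq : q ≠ 0)
    (hR : Integrable (fun ω =>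
      (W ω + B ω) ^ (q + 1) - W ω ^ (q + 1) - ((q : ℝ) + 1) * (W ω ^ q * B ω)) P) :
    Integrable (fun ω => W ω ^ q) P ∧
      ((q : ℝ) + 1) * (1 - lam * ∫ ω, B ω ∂P) * ∫ ω, W ω ^ q ∂P =
        lam * ∫ ω, ((W ω + B ω) ^ (q + 1) - W ω ^ (q + 1)
          - ((q : ℝ) + 1) * (W ω ^ q * B ω)) ∂P := by
  set R : Ω → ℝ := fun ω =>
    (W ω + B ω) ^ (q + 1) - W ω ^ (q + 1) - ((q : ℝ) + 1) * (W ω ^ q * B ω) with hRdef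
  set φ : ℕ → Set Ω := fun n => {ω | W ω ≤ (n : ℝ) + 1} with hφ
  have hs : ∀ n, MeasurableSet (φ n) := fun n => measurableSet_le mW measurable_const
  have hcov : AECover P Filter.atTop φ := by
    refine ⟨Filter.Eventually.of_forall fun ω => ?_, hs⟩
    filter_upwards [Filter.eventually_ge_atTop ⌈W ω⌉₊] with n hn
    have h1 := Nat.le_ceil (W ω)
    have h2 : ((⌈W ω⌉₊ : ℕ) : ℝ) ≤ n := by exact_mod_cast hn
    change W ω ≤ (n : ℝ) + 1
    linarith
  have hpos : ∀ n : ℕ, (0 : ℝ) < (n : ℝ) + 1 := fun n => by positivity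
  have WB0 : ∀ᵐ ω ∂P, 0 ≤ W ω + B ω := by filter_upwards [W0, B0] with ω h1 h2; linarith
  have hint : ∀ n, IntegrableOn (fun ω => W ω ^ q) (φ n) P := fun n =>
    integrableOn_pow_le mW W0 _ q
  set D : ℕ → Ω → ℝ := fun n ω =>
    min (W ω + B ω) ((n : ℝ) + 1) ^ (q + 1) - min (W ω) ((n : ℝ) + 1) ^ (q + 1) with hD
  have hcons : ∀ n, ((q : ℝ) + 1) * ∫ ω in φ n, W ω ^ q ∂P = lam * ∫ ω, D n ω ∂P := fun n =>
    rate_conservation_cappedPow hlam mW mB mT W0 B0 hT hind hstat (hpos n) hq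
  have hR0 : ∀ᵐ ω ∂P, 0 ≤ R ω := by
    filter_upwards [W0, B0] with ω h1 h2
    have := pow_add_mul_le_add_pow h1 (by linarith : 0 ≤ 2 * W ω + B ω) (q + 1)
    simp only [hRdef]
    push_cast at this
    linarith
  -- the gain at an arrival is at most the untruncated gain, and vanishes above the cap
  have hDle : ∀ n, ∀ᵐ ω ∂P, 0 ≤ D n ω ∧
      D n ω ≤ ((q : ℝ) + 1) * ((φ n).indicator (fun ω => W ω ^ q) ω * B ω) + R ω := by
    intro n
    filter_upwards [W0, B0, hR0] with ω h1 h2 h3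
    have hc : min (W ω) ((n : ℝ) + 1) ≤ min (W ω + B ω) ((n : ℝ) + 1) :=
      min_le_min_right _ (by linarith)
    have h0 : 0 ≤ min (W ω) ((n : ℝ) + 1) := le_min h1 (hpos n).le
    refine ⟨sub_nonneg.2 (pow_le_pow_left₀ h0 hc _), ?_⟩
    by_cases hω : W ω ≤ (n : ℝ) + 1
    · have hm : ω ∈ φ n := hω
      have := pow_le_pow_left₀ (h0.trans hc) (min_le_left (W ω + B ω) ((n : ℝ) + 1)) (q + 1)
      simp only [hD, Set.indicator_of_mem hm, min_eq_left hω, hRdef]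
      linarith
    · have hm : ω ∉ φ n := hω
      have hω := (not_le.1 hω).le
      simp only [hD, Set.indicator_of_notMem hm, min_eq_right hω,
        min_eq_right (hω.trans (by linarith : W ω ≤ W ω + B ω))]
      simpa using h3
  have hindic : ∀ n, Integrable ((φ n).indicator fun ω => W ω ^ q) P := fun n =>
    (integrable_indicator_iff (hs n)).2 (hint n)
  have hindep : ∀ n, IndepFun ((φ n).indicator fun ω => W ω ^ q) B P := by
    intro n
    have : Measurable ((Set.Iic ((n : ℝ) + 1)).indicator fun x : ℝ => x ^ q) :=
      (measurable_id.pow_const q).indicator measurableSet_Iic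
    exact hWB.comp this measurable_id
  have hprod : ∀ n, Integrable (fun ω => (φ n).indicator (fun ω => W ω ^ q) ω * B ω) P := fun n =>
    (hindep n).integrable_mul (hindic n) hB
  have hprod_int : ∀ n, ∫ ω, (φ n).indicator (fun ω => W ω ^ q) ω * B ω ∂P =
      (∫ ω in φ n, W ω ^ q ∂P) * ∫ ω, B ω ∂P := fun n => by
    rw [← integral_indicator (hs n)]
    exact (hindep n).integral_mul_eq_mul_integral (hindic n).aestronglyMeasurable
      hB.aestronglyMeasurable
  have hDint : ∀ n, Integrable (D n) P := fun n =>
    (integrable_cappedPow (mW.add mB) WB0 (hpos n) _).sub (integrable_cappedPow mW W0 (hpos n) _)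
  have hbound : ∀ n, ∫ ω in φ n, W ω ^ q ∂P ≤
      lam * (∫ ω, R ω ∂P) / (((q : ℝ) + 1) * (1 - lam * ∫ ω, B ω ∂P)) := by
    intro n
    have h1 : ∫ ω, D n ω ∂P ≤
        ((q : ℝ) + 1) * ((∫ ω in φ n, W ω ^ q ∂P) * ∫ ω, B ω ∂P) + ∫ ω, R ω ∂P := by
      rw [← hprod_int, ← integral_const_mul, ← integral_add ((hprod n).const_mul _) hR]
      refine integral_mono_ae (hDint n) (((hprod n).const_mul _).add hR) ?_
      filter_upwards [hDle n] with ω h using h.2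
    have h2 := hcons n
    have h3 := mul_le_mul_of_nonneg_left h1 hlam.le
    have h4 : 0 < ((q : ℝ) + 1) * (1 - lam * ∫ ω, B ω ∂P) := mul_pos (by positivity) (by linarith)
    rw [le_div_iff₀ h4]
    linarith
  have hW : Integrable (fun ω => W ω ^ q) P := by
    refine hcov.integrable_of_integral_bounded_of_nonneg_ae _ hint ?_
      (Filter.Eventually.of_forall hbound)
    filter_upwards [W0] with ω h
    positivity
  refine ⟨hW, ?_⟩
  have hindepW : IndepFun (fun ω => W ω ^ q) B P :=
    hWB.comp (measurable_id.pow_const q) measurable_id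
  have hWBi : Integrable (fun ω => W ω ^ q * B ω) P := hindepW.integrable_mul hW hB
  have hWBe : ∫ ω, W ω ^ q * B ω ∂P = (∫ ω, W ω ^ q ∂P) * ∫ ω, B ω ∂P :=
    hindepW.integral_mul_eq_mul_integral hW.aestronglyMeasurable hB.aestronglyMeasurable
  have hl1 := (hcov.integral_tendsto_of_countably_generated hW).const_mul ((q : ℝ) + 1)
  have hl2 : Filter.Tendsto (fun n => ∫ ω, D n ω ∂P) Filter.atTop
      (nhds (∫ ω, (((q : ℝ) + 1) * (W ω ^ q * B ω) + R ω) ∂P)) := by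
    refine tendsto_integral_of_dominated_convergence
      (fun ω => ((q : ℝ) + 1) * (W ω ^ q * B ω) + R ω) (fun n => (hDint n).aestronglyMeasurable)
      ((hWBi.const_mul _).add hR) (fun n => ?_) (Filter.Eventually.of_forall fun ω => ?_)
    · filter_upwards [hDle n, W0, B0] with ω h h1 h2
      rw [Real.norm_eq_abs, abs_of_nonneg h.1]
      have h3 : (φ n).indicator (fun ω => W ω ^ q) ω ≤ W ω ^ q :=
        Set.indicator_apply_le' (fun _ => le_rfl) fun _ => by positivity
      refine h.2.trans ?_
      gcongr
    · refine tendsto_const_nhds.congr' ?_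
      filter_upwards [Filter.eventually_ge_atTop ⌈max (W ω) (W ω + B ω)⌉₊] with n hn
      have h1 := Nat.le_ceil (max (W ω) (W ω + B ω))
      have h2 : ((⌈max (W ω) (W ω + B ω)⌉₊ : ℕ) : ℝ) ≤ n := by exact_mod_cast hn
      have h3 := le_max_left (W ω) (W ω + B ω)
      have h4 := le_max_right (W ω) (W ω + B ω)
      simp only [hD, hRdef, min_eq_left (by linarith : W ω ≤ (n : ℝ) + 1),
        min_eq_left (by linarith : W ω + B ω ≤ (n : ℝ) + 1)]
      ring
  have hlim := tendsto_nhds_unique hl1 ((hl2.const_mul lam).congr fun n => (hcons n).symm)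
  rw [integral_add (hWBi.const_mul _) hR, integral_const_mul, hWBe] at hlim
  linarith

/-- Pollaczek-Khinchine formulas for the first two moments of the stationary workload of a queue
with exponential interarrival times of rate `lam` and work `B` per arrival. -/
theorem workload_moments (hlam : 0 < lam) (mW : Measurable W) (mB : Measurable B)
    (mT : Measurable T) (W0 : ∀ᵐ ω ∂P, 0 ≤ W ω) (B0 : ∀ᵐ ω ∂P, 0 ≤ B ω)
    (hT : P.map T = expMeasure lam) (hind : IndepFun (fun ω => (W ω, B ω)) T P)
    (hWB : IndepFun W B P)
    (hstat : P.map (fun ω => max (W ω + B ω - T ω) 0) = P.map W)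
    (hB : MemLp B 3 P) (hrho : lam * ∫ ω, B ω ∂P < 1) :
    MemLp W 2 P ∧
      ∫ ω, W ω ∂P = lam * (∫ ω, B ω ^ 2 ∂P) / (2 * (1 - lam * ∫ ω, B ω ∂P)) ∧
      ∫ ω, W ω ^ 2 ∂P = 2 * (∫ ω, W ω ∂P) ^ 2 +
        lam * (∫ ω, B ω ^ 3 ∂P) / (3 * (1 - lam * ∫ ω, B ω ∂P)) := by
  have hB1 : Integrable B P := hB.integrable (by norm_num)
  have hB2 : Integrable (fun ω => B ω ^ 2) P := (hB.mono_exponent (by norm_num)).integrable_sq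
  have hB3 : Integrable (fun ω => B ω ^ 3) P := by
    refine (hB.integrable_norm_pow (by norm_num)).congr ?_
    filter_upwards [B0] with ω h
    rw [Real.norm_eq_abs, abs_of_nonneg h]
  have hrho' : 1 - lam * ∫ ω, B ω ∂P ≠ 0 := by linarith
  have e1 : (fun ω => (W ω + B ω) ^ (1 + 1) - W ω ^ (1 + 1) - (((1 : ℕ) : ℝ) + 1) * (W ω ^ 1 * B ω))
      = fun ω => B ω ^ 2 := by ext ω; push_cast; ring
  obtain ⟨i1, m1⟩ := integrable_pow_workload hlam mW mB mT W0 B0 hT hind hWB hstat hB1 hrho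
    one_ne_zero (by rw [e1]; exact hB2)
  rw [e1] at m1
  simp only [pow_one] at i1 m1
  have hWB2 : IndepFun W (fun ω => B ω ^ 2) P := hWB.comp measurable_id (measurable_id.pow_const 2)
  have iWB2 : Integrable (fun ω => W ω * B ω ^ 2) P := hWB2.integrable_mul i1 hB2
  have e2 : (fun ω => (W ω + B ω) ^ (2 + 1) - W ω ^ (2 + 1) - (((2 : ℕ) : ℝ) + 1) * (W ω ^ 2 * B ω))
      = fun ω => 3 * (W ω * B ω ^ 2) + B ω ^ 3 := by ext ω; push_cast; ring
  obtain ⟨i2, m2⟩ := integrable_pow_workload hlam mW mB mT W0 B0 hT hind hWB hstat hB1 hrho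
    two_ne_zero (by rw [e2]; exact (iWB2.const_mul 3).add hB3)
  have hprod : ∫ ω, W ω * B ω ^ 2 ∂P = (∫ ω, W ω ∂P) * ∫ ω, B ω ^ 2 ∂P :=
    hWB2.integral_mul_eq_mul_integral i1.aestronglyMeasurable hB2.aestronglyMeasurable
  rw [e2, integral_add (iWB2.const_mul 3) hB3, integral_const_mul, hprod] at m2
  have r1 : ∫ ω, W ω ∂P = lam * (∫ ω, B ω ^ 2 ∂P) / (2 * (1 - lam * ∫ ω, B ω ∂P)) := by
    rw [eq_div_iff (by simpa using hrho')]
    push_cast at m1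
    linarith
  refine ⟨(memLp_two_iff_integrable_sq mW.aestronglyMeasurable).2 i2, r1, ?_⟩
  have r2 : lam * (∫ ω, B ω ^ 2 ∂P) = 2 * (1 - lam * ∫ ω, B ω ∂P) * ∫ ω, W ω ∂P := by
    push_cast at m1
    linarith
  push_cast at m2
  have : 2 * (∫ ω, W ω ∂P) ^ 2 + lam * (∫ ω, B ω ^ 3 ∂P) / (3 * (1 - lam * ∫ ω, B ω ∂P)) =
      (6 * (1 - lam * ∫ ω, B ω ∂P) * (∫ ω, W ω ∂P) ^ 2 + lam * (∫ ω, B ω ^ 3 ∂P)) /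
        (3 * (1 - lam * ∫ ω, B ω ∂P)) := by
    field_simp
    ring
  rw [this, eq_div_iff (by simpa using hrho')]
  linear_combination m2 + 3 * (∫ ω, W ω ∂P) * r2

end Queue

/-! ### Independence, selection probabilities and moments of the marks -/

/-- If `Y`, `Z`, `X` are independent, then so are the pair `(X, Z)` and `Y`. -/
lemma indepFun_prodMk_of_indepFun {Ω α β γ : Type*} [MeasurableSpace Ω] [MeasurableSpace α]
    [MeasurableSpace β] [MeasurableSpace γ] {P : Measure Ω} [IsProbabilityMeasure P]
    {X : Ω → α} {Y : Ω → β} {Z : Ω → γ} (mX : Measurable X) (mY : Measurable Y)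
    (mZ : Measurable Z) (h1 : IndepFun (fun ω => (Y ω, Z ω)) X P) (h2 : IndepFun Y Z P) :
    IndepFun (fun ω => (X ω, Z ω)) Y P := by
  have hZX : IndepFun Z X P := h1.comp measurable_snd measurable_id
  have := Measure.isProbabilityMeasure_map (μ := P) mX.aemeasurable
  have := Measure.isProbabilityMeasure_map (μ := P) mY.aemeasurable
  have := Measure.isProbabilityMeasure_map (μ := P) mZ.aemeasurable
  rw [indepFun_iff_map_prod_eq_prod_map_map (by fun_prop) (by fun_prop)] at h1 h2 ⊢
  rw [indepFun_iff_map_prod_eq_prod_map_map (by fun_prop) (by fun_prop)] at hZX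
  have hXZ : P.map (fun ω => (X ω, Z ω)) = (P.map X).prod (P.map Z) := by
    rw [← Measure.prod_swap, ← hZX, Measure.map_map measurable_swap (by fun_prop)]
    rfl
  rw [h2] at h1
  have e1 : P.map (fun ω => (Y ω, (Z ω, X ω))) = (P.map Y).prod ((P.map Z).prod (P.map X)) := by
    rw [← Measure.prodAssoc_prod, ← h1, Measure.map_map (by fun_prop) (by fun_prop)]
    rfl
  have e2 : P.map (fun ω => (Y ω, (X ω, Z ω))) = (P.map Y).prod ((P.map X).prod (P.map Z)) := by
    have := ((MeasurePreserving.id (P.map Y)).prod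
      (Measure.measurePreserving_swap (μ := P.map Z) (ν := P.map X))).map_eq
    rw [← this, ← e1, Measure.map_map (by fun_prop) (by fun_prop)]
    rfl
  rw [hXZ, ← Measure.prod_swap, ← e2, Measure.map_map (by fun_prop) (by fun_prop)]
  rfl

namespace StorageSystem

variable {r m : ℕ} (sys : StorageSystem r m)

lemma sum_dispatch (i : Fin r) : ∑ A, (sys.dispatch i A).toReal = 1 := by
  have h := (sys.dispatch i).tsum_coe
  rw [tsum_fintype] at h
  rw [← ENNReal.toReal_sum fun A _ => (sys.dispatch i).apply_ne_top A, h, ENNReal.toReal_one]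

lemma selProb_nonneg (i : Fin r) (j : Fin m) : 0 ≤ sys.selProb i j :=
  Finset.sum_nonneg fun A _ => by split_ifs <;> positivity

lemma selProb_le_one (i : Fin r) (j : Fin m) : sys.selProb i j ≤ 1 := by
  rw [← sys.sum_dispatch i]
  exact Finset.sum_le_sum fun A _ => by split_ifs <;> simp

lemma dispatch_eq_zero_or (i : Fin r) (A : Finset (Fin m)) :
    (sys.dispatch i A).toReal = 0 ∨ A ⊆ sys.placement i ∧ A.card = sys.k i - sys.d i := by
  by_cases h : A ∈ (sys.dispatch i).support
  · exact Or.inr ⟨sys.dispatch_subset i A h, sys.dispatch_card i A h⟩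
  · left
    rw [PMF.mem_support_iff, not_not] at h
    simp [h]

lemma selProb_eq_zero {i : Fin r} {j : Fin m} (hj : j ∉ sys.placement i) :
    sys.selProb i j = 0 := by
  refine Finset.sum_eq_zero fun A _ => ?_
  split_ifs with h
  · exact (sys.dispatch_eq_zero_or i A).resolve_right fun h' => hj (h'.1 h)
  · rfl

lemma sum_selProb_univ (i : Fin r) : ∑ j, sys.selProb i j = ((sys.k i - sys.d i : ℕ) : ℝ) := by
  unfold selProb
  rw [Finset.sum_comm]
  have : ∀ A : Finset (Fin m), ∑ j, (if j ∈ A then (sys.dispatch i A).toReal else 0) =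
      (sys.dispatch i A).toReal * ((sys.k i - sys.d i : ℕ) : ℝ) := fun A => by
    rcases sys.dispatch_eq_zero_or i A with h | h
    · simp [h]
    · rw [← h.2, ← Finset.sum_filter]
      simp [mul_comm]
  rw [Finset.sum_congr rfl fun A _ => this A, ← Finset.sum_mul, sum_dispatch, one_mul]

lemma sum_selProb (i : Fin r) :
    ∑ j ∈ sys.placement i, sys.selProb i j = ((sys.k i - sys.d i : ℕ) : ℝ) := by
  rw [← sum_selProb_univ]
  exact Finset.sum_subset (Finset.subset_univ _) fun j _ hj => sys.selProb_eq_zero hj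

variable {sys}

lemma totalRate_pos {i : Fin r} (hi : 0 < sys.rate i) : 0 < sys.totalRate :=
  Finset.sum_pos' (fun i _ => sys.rate_nonneg i) ⟨i, Finset.mem_univ _, hi⟩

lemma markLaw_apply (s : Set (Fin r × Finset (Fin m))) :
    sys.markLaw s = ∑ i, ∑ A, ENNReal.ofReal (sys.rate i / sys.totalRate) * sys.dispatch i A *
      s.indicator 1 (i, A) := by
  simp only [markLaw, Measure.finsetSum_apply, Measure.smul_apply,
    Measure.dirac_apply' _ (MeasurableSet.of_discrete (s := s)), smul_eq_mul]

lemma markLaw_real (hpos : 0 < sys.totalRate) (s : Set (Fin r × Finset (Fin m))) :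
    sys.markLaw.real s = ∑ i, ∑ A, sys.rate i / sys.totalRate * (sys.dispatch i A).toReal *
      s.indicator 1 (i, A) := by
  have hfin : ∀ i A, ENNReal.ofReal (sys.rate i / sys.totalRate) * sys.dispatch i A *
      s.indicator 1 (i, A) ≠ ⊤ := fun i A => by
    refine ENNReal.mul_ne_top (ENNReal.mul_ne_top (by simp) ((sys.dispatch i).apply_ne_top A)) ?_
    by_cases h : (i, A) ∈ s <;> simp [h]
  rw [measureReal_def, markLaw_apply, ENNReal.toReal_sum fun i _ =>
    ENNReal.sum_ne_top.2 fun A _ => hfin i A]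
  refine Finset.sum_congr rfl fun i _ => ?_
  rw [ENNReal.toReal_sum fun A _ => hfin i A]
  refine Finset.sum_congr rfl fun A _ => ?_
  rw [ENNReal.toReal_mul, ENNReal.toReal_mul,
    ENNReal.toReal_ofReal (div_nonneg (sys.rate_nonneg i) hpos.le)]
  by_cases h : (i, A) ∈ s <;> simp [h]

lemma isProbabilityMeasure_markLaw (hpos : 0 < sys.totalRate) :
    IsProbabilityMeasure sys.markLaw := by
  have h : sys.markLaw.real Set.univ = 1 := by
    rw [markLaw_real hpos]
    simp only [Set.indicator_univ, Pi.one_apply, mul_one]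
    simp_rw [← Finset.mul_sum, sum_dispatch, mul_one, ← Finset.sum_div]
    exact div_self hpos.ne'
  refine ⟨?_⟩
  rw [measureReal_def] at h
  rwa [ENNReal.toReal_eq_one_iff] at h

lemma markLaw_real_file (hpos : 0 < sys.totalRate) (i : Fin r) :
    sys.markLaw.real {p | p.1 = i} = sys.rate i / sys.totalRate := by
  rw [markLaw_real hpos, Finset.sum_eq_single i]
  · simp [← Finset.mul_sum, sum_dispatch]
  · intro b _ hb
    simp [hb]
  · simp

lemma markLaw_real_file_node (hpos : 0 < sys.totalRate) (i : Fin r) (j : Fin m) :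
    sys.markLaw.real {p | p.1 = i ∧ j ∈ p.2} = sys.rate i / sys.totalRate * sys.selProb i j := by
  rw [markLaw_real hpos, Finset.sum_eq_single i]
  · simp only [selProb, Finset.mul_sum]
    refine Finset.sum_congr rfl fun A _ => ?_
    by_cases h : j ∈ A <;> simp [h]
  · intro b _ hb
    simp [hb]
  · simp

lemma markLaw_real_node (hpos : 0 < sys.totalRate) (j : Fin m) :
    sys.markLaw.real {p | j ∈ p.2} = sys.nodeRate j / sys.totalRate := by
  rw [markLaw_real hpos, nodeRate, Finset.sum_div]
  refine Finset.sum_congr rfl fun i _ => ?_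
  rw [mul_div_right_comm, selProb, Finset.mul_sum]
  refine Finset.sum_congr rfl fun A _ => ?_
  by_cases h : j ∈ A <;> simp [h]

lemma ae_markLaw :
    ∀ᵐ p ∂sys.markLaw, p.2 ⊆ sys.placement p.1 ∧ p.2.card = sys.k p.1 - sys.d p.1 := by
  rw [ae_iff_of_countable]
  rintro ⟨i, A⟩ h
  by_contra hc
  refine h ?_
  have h0 : sys.dispatch i A = 0 := by
    by_contra h1
    have := (PMF.mem_support_iff _ _).2 h1
    exact hc ⟨sys.dispatch_subset i A this, sys.dispatch_card i A this⟩
  rw [markLaw_apply]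
  refine Finset.sum_eq_zero fun i' _ => Finset.sum_eq_zero fun A' _ => ?_
  by_cases h : (i', A') = (i, A)
  · obtain ⟨rfl, rfl⟩ := Prod.mk.inj h
    simp [h0]
  · simp [h]

lemma serviceMom2_pos (j : Fin m) : 0 < sys.serviceMom2 j := by
  have := sys.service_prob
  have hLp : MemLp (fun x : Fin m → ℝ => x j) 2 sys.service :=
    (sys.service_memLp j).mono_exponent (by norm_num)
  have h1 := variance_eq_sub hLp
  have h2 := variance_nonneg (fun x : Fin m → ℝ => x j) sys.service
  have h3 := pow_pos (sys.service_mean_pos j) 2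
  have h4 : ∫ x, ((fun x : Fin m → ℝ => x j) ^ 2) x ∂sys.service = sys.serviceMom2 j := rfl
  linarith

lemma serviceMom3_nonneg (j : Fin m) : 0 ≤ sys.serviceMom3 j :=
  integral_nonneg_of_ae (by filter_upwards [sys.service_nonneg j] with x hx using by positivity)

lemma nodeRate_nonneg (j : Fin m) : 0 ≤ sys.nodeRate j :=
  Finset.sum_nonneg fun i _ => mul_nonneg (sys.rate_nonneg i) (sys.selProb_nonneg i j)

lemma delayMean_pos (hstable : ∀ j, sys.intensity j < 1) (j : Fin m) : 0 < sys.delayMean j := by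
  have h1 := sys.service_mean_pos j
  have h2 := serviceMom2_pos (sys := sys) j
  have h3 := nodeRate_nonneg (sys := sys) j
  have h4 : 0 < 1 - sys.intensity j := by linarith [hstable j]
  unfold delayMean serviceRate
  rw [one_div, inv_inv]
  positivity

lemma delayVar_nonneg (hstable : ∀ j, sys.intensity j < 1) (j : Fin m) : 0 ≤ sys.delayVar j := by
  have h1 : 0 ≤ sys.serviceVar j := variance_nonneg _ _
  have h2 := serviceMom3_nonneg (sys := sys) j
  have h3 := nodeRate_nonneg (sys := sys) j
  have h4 : 0 < 1 - sys.intensity j := by linarith [hstable j]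
  unfold delayVar
  positivity

/-- A node that requests of a file with positive rate can reach has a positive arrival rate, hence
a random queueing delay. -/
lemma delayVar_pos (hstable : ∀ j, sys.intensity j < 1) {i : Fin r} (hi : 0 < sys.rate i)
    {j : Fin m} (hj : 0 < sys.selProb i j) : 0 < sys.delayVar j := by
  have h1 : 0 ≤ sys.serviceVar j := variance_nonneg _ _
  have h2 := serviceMom3_nonneg (sys := sys) j
  have h3 : 0 < sys.nodeRate j := Finset.sum_pos'
    (fun i _ => mul_nonneg (sys.rate_nonneg i) (sys.selProb_nonneg i j))
    ⟨i, Finset.mem_univ _, mul_pos hi hj⟩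
  have h4 : 0 < 1 - sys.intensity j := by linarith [hstable j]
  have h5 := serviceMom2_pos (sys := sys) j
  unfold delayVar
  positivity

end StorageSystem

/-! ### Delays in steady state -/

namespace StorageSystem

variable {r m : ℕ} {sys : StorageSystem r m}

namespace SteadyState

variable {Ω : Type*} [MeasurableSpace Ω] {P : Measure Ω}
  (st : sys.SteadyState P)

/-- The data attached to request `n`: time to the next request, marks, service times. -/
def request (n : ℕ) (ω : Ω) : ℝ × (Fin r × Finset (Fin m)) × (Fin m → ℝ) :=
  (st.gap n ω, (st.file n ω, st.nodes n ω), st.work n ω)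

/-- Work that request `n` brings to node `j`. -/
noncomputable def newWork (n : ℕ) (j : Fin m) (ω : Ω) : ℝ :=
  if j ∈ st.nodes n ω then st.work n ω j else 0

lemma measurable_request (n : ℕ) : Measurable (st.request n) :=
  (st.measurable_gap n).prodMk
    (((st.measurable_file n).prodMk (st.measurable_nodes n)).prodMk (st.measurable_work n))

lemma measurable_marks (n : ℕ) : Measurable fun ω => (st.file n ω, st.nodes n ω) :=
  (st.measurable_file n).prodMk (st.measurable_nodes n)

lemma measurableSet_mem_nodes (n : ℕ) (j : Fin m) : MeasurableSet {ω | j ∈ st.nodes n ω} :=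
  (st.measurable_nodes n) (MeasurableSet.of_discrete (s := {A : Finset (Fin m) | j ∈ A}))

lemma measurable_load_apply (n : ℕ) (j : Fin m) : Measurable fun ω => st.load n ω j :=
  (measurable_pi_apply j).comp (st.measurable_load n)

lemma measurable_work_apply (n : ℕ) (j : Fin m) : Measurable fun ω => st.work n ω j :=
  (measurable_pi_apply j).comp (st.measurable_work n)

lemma measurable_newWork (n : ℕ) (j : Fin m) : Measurable (st.newWork n j) :=
  Measurable.ite (st.measurableSet_mem_nodes n j) (st.measurable_work_apply n j) measurable_const

lemma measurable_delay (n : ℕ) : Measurable (st.delay n) := by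
  refine measurable_pi_lambda _ fun j => ?_
  exact (st.measurable_load_apply n j).add (st.measurable_work_apply n j)

/-- The loads found by request `n` are a function of the initial loads and the earlier requests. -/
lemma exists_load_eq (n : ℕ) :
    ∃ Φ : (Fin m → ℝ) × (Fin n → ℝ × (Fin r × Finset (Fin m)) × (Fin m → ℝ)) → Fin m → ℝ,
      Measurable Φ ∧ ∀ ω, st.load n ω = Φ (st.load 0 ω, fun l : Fin n => st.request l ω) := by
  induction n with
  | zero => exact ⟨Prod.fst, measurable_fst, fun _ => rfl⟩
  | succ n ih =>
    obtain ⟨Φ, mΦ, hΦ⟩ := ih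
    refine ⟨fun p j => max (Φ (p.1, fun l => p.2 l.castSucc) j +
      (if j ∈ (p.2 (Fin.last n)).2.1.2 then (p.2 (Fin.last n)).2.2 j else 0)
        - (p.2 (Fin.last n)).1) 0, ?_, fun ω => ?_⟩
    · refine measurable_pi_lambda _ fun j => ?_
      have m1 : Measurable fun p : (Fin m → ℝ) ×
          (Fin (n + 1) → ℝ × (Fin r × Finset (Fin m)) × (Fin m → ℝ)) =>
          Φ (p.1, fun l => p.2 l.castSucc) j :=
        (measurable_pi_apply j).comp (mΦ.comp (by fun_prop))
      have m2 : Measurable fun p : (Fin m → ℝ) ×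
          (Fin (n + 1) → ℝ × (Fin r × Finset (Fin m)) × (Fin m → ℝ)) =>
          if j ∈ (p.2 (Fin.last n)).2.1.2 then (p.2 (Fin.last n)).2.2 j else 0 := by
        refine Measurable.ite ?_ (by fun_prop) measurable_const
        have : Measurable fun p : (Fin m → ℝ) ×
          (Fin (n + 1) → ℝ × (Fin r × Finset (Fin m)) × (Fin m → ℝ)) =>
            (p.2 (Fin.last n)).2.1.2 := by fun_prop
        exact this (MeasurableSet.of_discrete (s := {A : Finset (Fin m) | j ∈ A}))
      exact ((m1.add m2).sub (by fun_prop)).max measurable_const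
    · ext j
      rw [st.load_succ, hΦ]
      rfl

lemma indepFun_request_load (n : ℕ) : IndepFun (st.request n) (st.load n) P := by
  obtain ⟨Φ, mΦ, hΦ⟩ := st.exists_load_eq n
  rw [show st.load n = Φ ∘ fun ω => (st.load 0 ω, fun l : Fin n => st.request l ω) from funext hΦ]
  exact (st.request_indep n).comp measurable_id mΦ

lemma map_request (n : ℕ) : P.map (st.request n) = sys.requestLaw := st.request_law n

/-- A stationary load has the law of a later one, which the recursion makes nonnegative. -/
lemma ae_load_nonneg (n : ℕ) (j : Fin m) : ∀ᵐ ω ∂P, 0 ≤ st.load n ω j := by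
  have hs : MeasurableSet {x : Fin m → ℝ | 0 ≤ x j} :=
    measurableSet_le measurable_const (measurable_pi_apply j)
  have h1 : ∀ᵐ x ∂(P.map (st.load (n + 1))), 0 ≤ x j := by
    rw [ae_map_iff (st.measurable_load _).aemeasurable hs]
    exact Filter.Eventually.of_forall fun ω => by rw [st.load_succ]; exact le_max_right _ _
  rw [st.stationary, ← st.stationary n] at h1
  exact ae_of_ae_map (st.measurable_load n).aemeasurable h1

lemma map_gap (hpos : 0 < sys.totalRate) (n : ℕ) :
    P.map (st.gap n) = expMeasure sys.totalRate := by
  have := sys.service_prob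
  have := isProbabilityMeasure_markLaw hpos
  have := isProbabilityMeasure_expMeasure hpos
  have h : P.map (st.gap n) = (P.map (st.request n)).map Prod.fst := by
    rw [Measure.map_map measurable_fst (st.measurable_request n)]; rfl
  rw [h, map_request, requestLaw, Measure.map_fst_prod]
  simp

lemma map_marks_work (hpos : 0 < sys.totalRate) (n : ℕ) :
    P.map (fun ω => ((st.file n ω, st.nodes n ω), st.work n ω)) =
      sys.markLaw.prod sys.service := by
  have := sys.service_prob
  have := isProbabilityMeasure_markLaw hpos
  have := isProbabilityMeasure_expMeasure hpos
  have h : P.map (fun ω => ((st.file n ω, st.nodes n ω), st.work n ω)) =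
      (P.map (st.request n)).map Prod.snd := by
    rw [Measure.map_map measurable_snd (st.measurable_request n)]; rfl
  rw [h, map_request, requestLaw, Measure.map_snd_prod]
  simp

lemma map_marks (hpos : 0 < sys.totalRate) (n : ℕ) :
    P.map (fun ω => (st.file n ω, st.nodes n ω)) = sys.markLaw := by
  have := sys.service_prob
  have := isProbabilityMeasure_markLaw hpos
  have h : P.map (fun ω => (st.file n ω, st.nodes n ω)) =
      (P.map (fun ω => ((st.file n ω, st.nodes n ω), st.work n ω))).map Prod.fst := by
    rw [Measure.map_map measurable_fst ((st.measurable_marks n).prodMk (st.measurable_work n))]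
    rfl
  rw [h, st.map_marks_work hpos, Measure.map_fst_prod]
  simp

lemma map_work (hpos : 0 < sys.totalRate) (n : ℕ) : P.map (st.work n) = sys.service := by
  have := sys.service_prob
  have := isProbabilityMeasure_markLaw hpos
  have h : P.map (st.work n) =
      (P.map (fun ω => ((st.file n ω, st.nodes n ω), st.work n ω))).map Prod.snd := by
    rw [Measure.map_map measurable_snd ((st.measurable_marks n).prodMk (st.measurable_work n))]
    rfl
  rw [h, st.map_marks_work hpos, Measure.map_snd_prod]
  simp

lemma indepFun_marks_work [IsProbabilityMeasure P] (hpos : 0 < sys.totalRate) (n : ℕ) :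
    IndepFun (fun ω => (st.file n ω, st.nodes n ω)) (st.work n) P := by
  rw [indepFun_iff_map_prod_eq_prod_map_map (st.measurable_marks n).aemeasurable
    (st.measurable_work n).aemeasurable, st.map_marks_work hpos, st.map_marks hpos,
    st.map_work hpos]

lemma indepFun_gap_marks_work [IsProbabilityMeasure P] (hpos : 0 < sys.totalRate) (n : ℕ) :
    IndepFun (st.gap n) (fun ω => ((st.file n ω, st.nodes n ω), st.work n ω)) P := by
  rw [indepFun_iff_map_prod_eq_prod_map_map (st.measurable_gap n).aemeasurable
    ((st.measurable_marks n).prodMk (st.measurable_work n)).aemeasurable, st.map_marks_work hpos,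
    st.map_gap hpos]
  exact st.request_law n

/-- The delays that request `n` would meet at the nodes are independent of its file and of the
nodes selected for it. -/
lemma indepFun_delay_marks [IsProbabilityMeasure P] (hpos : 0 < sys.totalRate) (n : ℕ) :
    IndepFun (st.delay n) (fun ω => (st.file n ω, st.nodes n ω)) P := by
  have h := indepFun_prodMk_of_indepFun (st.measurable_load n) (st.measurable_marks n)
    (st.measurable_work n) ((st.indepFun_request_load n).comp measurable_snd measurable_id)
    (st.indepFun_marks_work hpos n)
  have hadd : Measurable fun p : (Fin m → ℝ) × (Fin m → ℝ) => fun j => p.1 j + p.2 j := by fun_prop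
  exact h.comp hadd measurable_id

lemma measurable_newWork_of_request (j : Fin m) :
    Measurable fun p : (Fin r × Finset (Fin m)) × (Fin m → ℝ) =>
      if j ∈ p.1.2 then p.2 j else 0 := by
  refine Measurable.ite ?_ (by fun_prop) measurable_const
  have : Measurable fun p : (Fin r × Finset (Fin m)) × (Fin m → ℝ) => p.1.2 := by fun_prop
  exact this (MeasurableSet.of_discrete (s := {A : Finset (Fin m) | j ∈ A}))

lemma indepFun_load_newWork_gap [IsProbabilityMeasure P] (hpos : 0 < sys.totalRate) (n : ℕ)
    (j : Fin m) :
    IndepFun (fun ω => (st.load n ω j, st.newWork n j ω)) (st.gap n) P := by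
  have h := indepFun_prodMk_of_indepFun (st.measurable_load n) (st.measurable_gap n)
    ((st.measurable_marks n).prodMk (st.measurable_work n)) (st.indepFun_request_load n)
    (st.indepFun_gap_marks_work hpos n)
  have hm : Measurable fun p : (Fin m → ℝ) × ((Fin r × Finset (Fin m)) × (Fin m → ℝ)) =>
      (p.1 j, if j ∈ p.2.1.2 then p.2.2 j else 0) :=
    ((measurable_pi_apply j).comp measurable_fst).prodMk
      ((measurable_newWork_of_request j).comp measurable_snd)
  exact h.comp hm measurable_id

lemma indepFun_load_newWork (n : ℕ) (j : Fin m) :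
    IndepFun (fun ω => st.load n ω j) (st.newWork n j) P :=
  (st.indepFun_request_load n).symm.comp (measurable_pi_apply j)
    ((measurable_newWork_of_request j).comp measurable_snd)

lemma indepFun_load_work (n : ℕ) (j : Fin m) :
    IndepFun (fun ω => st.load n ω j) (fun ω => st.work n ω j) P :=
  (st.indepFun_request_load n).symm.comp (measurable_pi_apply j)
    ((measurable_pi_apply j).comp (measurable_snd.comp measurable_snd))

lemma integral_work (hpos : 0 < sys.totalRate) (n : ℕ) {f : (Fin m → ℝ) → ℝ} (hf : Measurable f) :
    ∫ ω, f (st.work n ω) ∂P = ∫ x, f x ∂sys.service := by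
  rw [← st.map_work hpos n, integral_map (st.measurable_work n).aemeasurable
    hf.aestronglyMeasurable]

lemma memLp_work (hpos : 0 < sys.totalRate) (n : ℕ) (j : Fin m) :
    MemLp (fun ω => st.work n ω j) 3 P := by
  have h := sys.service_memLp j
  rw [← st.map_work hpos n] at h
  exact h.comp_of_map (st.measurable_work n).aemeasurable

lemma ae_work_nonneg (hpos : 0 < sys.totalRate) (n : ℕ) (j : Fin m) :
    ∀ᵐ ω ∂P, 0 ≤ st.work n ω j := by
  have h := sys.service_nonneg j
  rw [← st.map_work hpos n] at h
  exact ae_of_ae_map (st.measurable_work n).aemeasurable h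

lemma memLp_newWork (hpos : 0 < sys.totalRate) (n : ℕ) (j : Fin m) :
    MemLp (st.newWork n j) 3 P := by
  refine (st.memLp_work hpos n j).mono (st.measurable_newWork n j).aestronglyMeasurable
    (Filter.Eventually.of_forall fun ω => ?_)
  unfold newWork
  split_ifs <;> simp

lemma measureReal_mem_nodes (hpos : 0 < sys.totalRate) (n : ℕ) (j : Fin m) :
    P.real {ω | j ∈ st.nodes n ω} = sys.nodeRate j / sys.totalRate := by
  rw [← markLaw_real_node hpos, ← st.map_marks hpos n,
    map_measureReal_apply (st.measurable_marks n) MeasurableSet.of_discrete]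
  rfl

lemma integral_newWork_pow [IsProbabilityMeasure P] (hpos : 0 < sys.totalRate) (n : ℕ) (j : Fin m)
    {p : ℕ} (hp : p ≠ 0) :
    sys.totalRate * ∫ ω, st.newWork n j ω ^ p ∂P =
      sys.nodeRate j * ∫ x, x j ^ p ∂sys.service := by
  have hs := st.measurableSet_mem_nodes n j
  have hind : IndepFun ({ω | j ∈ st.nodes n ω}.indicator (1 : Ω → ℝ))
      (fun ω => st.work n ω j ^ p) P := by
    have h1 : Measurable ({q : Fin r × Finset (Fin m) | j ∈ q.2}.indicator
        (1 : Fin r × Finset (Fin m) → ℝ)) := Measurable.of_discrete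
    exact (st.indepFun_marks_work hpos n).comp h1 ((measurable_pi_apply j).pow_const p)
  have e : (fun ω => st.newWork n j ω ^ p) =
      {ω | j ∈ st.nodes n ω}.indicator (1 : Ω → ℝ) * fun ω => st.work n ω j ^ p := by
    ext ω
    by_cases h : j ∈ st.nodes n ω <;> simp [newWork, h, hp]
  have mw : Measurable fun ω => st.work n ω j ^ p := (st.measurable_work_apply n j).pow_const p
  rw [e, hind.integral_mul_eq_mul_integral (measurable_one.indicator hs).aestronglyMeasurable
    mw.aestronglyMeasurable, integral_indicator_one hs, st.measureReal_mem_nodes hpos,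
    st.integral_work hpos n (f := fun x => x j ^ p) (by fun_prop)]
  field_simp

/-- The delay of a chunk request has the mean and variance of the Pollaczek-Khinchine formulas. The
work arriving at node `j` with a file request vanishes unless `j` is selected; multiplying its
moments by the total rate gives the service moments multiplied by the rate of node `j`. -/
theorem delay_moments [IsProbabilityMeasure P] (hpos : 0 < sys.totalRate)
    (hstable : ∀ j, sys.intensity j < 1) (n : ℕ) (j : Fin m) :
    MemLp (fun ω => st.delay n ω j) 2 P ∧
      ∫ ω, st.delay n ω j ∂P = sys.delayMean j ∧
      variance (fun ω => st.delay n ω j) P = sys.delayVar j := by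
  have hst := hstable j
  have hmean : sys.totalRate * ∫ ω, st.newWork n j ω ∂P = sys.intensity j := by
    have := st.integral_newWork_pow hpos n j one_ne_zero
    simp only [pow_one] at this
    rw [this, intensity, serviceRate, div_inv_eq_mul]
  have hstat : P.map (fun ω => max (st.load n ω j + st.newWork n j ω - st.gap n ω) 0) =
      P.map fun ω => st.load n ω j := by
    have h1 : (fun ω => max (st.load n ω j + st.newWork n j ω - st.gap n ω) 0) =
        fun ω => st.load (n + 1) ω j := by
      ext ω
      rw [st.load_succ]
      rfl
    have h2 : ∀ k, P.map (fun ω => st.load k ω j) = (P.map (st.load k)).map (fun x => x j) :=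
      fun k => by
        rw [Measure.map_map (measurable_pi_apply j) (st.measurable_load k)]; rfl
    rw [h1, h2, h2, st.stationary, st.stationary n]
  obtain ⟨hL, hm1, hm2⟩ := workload_moments hpos (st.measurable_load_apply n j)
    (st.measurable_newWork n j) (st.measurable_gap n) (st.ae_load_nonneg n j)
    (by
      filter_upwards [st.ae_work_nonneg hpos n j] with ω h
      unfold newWork
      split_ifs
      exacts [h, le_rfl])
    (st.map_gap hpos n) (st.indepFun_load_newWork_gap hpos n j) (st.indepFun_load_newWork n j)
    hstat (st.memLp_newWork hpos n j) (by rw [hmean]; exact hst)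
  rw [hmean, st.integral_newWork_pow hpos n j two_ne_zero] at hm1
  rw [hmean, st.integral_newWork_pow hpos n j three_ne_zero] at hm2
  have hX : MemLp (fun ω => st.work n ω j) 2 P :=
    (st.memLp_work hpos n j).mono_exponent (by norm_num)
  have hd : (fun ω => st.delay n ω j) =
      (fun ω => st.load n ω j) + fun ω => st.work n ω j := rfl
  have hne : 1 - sys.intensity j ≠ 0 := by linarith
  refine ⟨hd ▸ hL.add hX, ?_, ?_⟩
  · simp only [delay]
    rw [integral_add (hL.integrable (by norm_num)) (hX.integrable (by norm_num)), hm1,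
      st.integral_work hpos n (f := fun x => x j) (by fun_prop)]
    simp only [delayMean, serviceMom2, serviceRate, one_div, inv_inv]
    ring
  · have hv : variance (fun ω => st.work n ω j) P = sys.serviceVar j := by
      rw [serviceVar, ← st.map_work hpos n, variance_map (measurable_pi_apply j).aemeasurable
        (st.measurable_work n).aemeasurable]
      rfl
    have hq : ∫ ω, ((fun ω => st.load n ω j) ^ 2) ω ∂P = ∫ ω, st.load n ω j ^ 2 ∂P := rfl
    rw [hd, (st.indepFun_load_work n j).variance_add hL hX, hv, variance_eq_sub hL, hq, hm2, hm1]
    simp only [delayVar, serviceMom2, serviceMom3]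
    field_simp
    ring

end SteadyState

end StorageSystem

/-! ### The bound and its objective -/

section Bound

variable {m : ℕ}

lemma maxDelay_eq {A : Finset (Fin m)} (hA : A.Nonempty) (q : Fin m → ℝ) :
    maxDelay A q = A.sup' hA q := by
  rw [maxDelay, dif_pos hA]

lemma maxDelay_le {A : Finset (Fin m)} (hA : A.Nonempty) (q : Fin m → ℝ) (z : ℝ) :
    maxDelay A q ≤ z + ∑ j ∈ A, max (q j - z) 0 := by
  rw [maxDelay_eq hA]
  refine Finset.sup'_le hA _ fun j hj => ?_
  have h1 := Finset.single_le_sum (f := fun j => max (q j - z) 0) (fun _ _ => le_max_right _ _) hj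
  have h2 := le_max_left (q j - z) 0
  linarith

lemma abs_maxDelay_le (A : Finset (Fin m)) (q : Fin m → ℝ) : |maxDelay A q| ≤ ∑ j, |q j| := by
  by_cases hA : A.Nonempty
  · obtain ⟨j, _, hj⟩ := A.exists_mem_eq_sup' hA q
    rw [maxDelay_eq hA, hj]
    exact Finset.single_le_sum (f := fun j => |q j|) (fun _ _ => abs_nonneg _) (Finset.mem_univ j)
  · rw [maxDelay, dif_neg hA, abs_zero]
    exact Finset.sum_nonneg fun _ _ => abs_nonneg _

lemma measurable_maxDelay :
    Measurable fun p : Finset (Fin m) × (Fin m → ℝ) => maxDelay p.1 p.2 := by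
  refine measurable_from_prod_countable_right fun A => ?_
  by_cases hA : A.Nonempty
  · simp only [maxDelay, dif_pos hA]
    have := Finset.measurable_sup' (f := fun (j : Fin m) (q : Fin m → ℝ) => q j) hA
      fun j _ => measurable_pi_apply j
    convert this using 1
    ext q
    simp
  · simp only [maxDelay, dif_neg hA]
    exact measurable_const

lemma integrable_maxDelay {Ω : Type*} [MeasurableSpace Ω] {P : Measure Ω}
    {N : Ω → Finset (Fin m)} {Q : Ω → Fin m → ℝ} (mN : Measurable N) (mQ : Measurable Q)
    (hQ : ∀ j, Integrable (fun ω => Q ω j) P) :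
    Integrable (fun ω => maxDelay (N ω) (Q ω)) P := by
  refine (integrable_finsetSum Finset.univ fun j _ => (hQ j).abs).mono'
    (measurable_maxDelay.comp (mN.prodMk mQ)).aestronglyMeasurable
    (Filter.Eventually.of_forall fun ω => abs_maxDelay_le _ _)

/-- Scarf's bound: `E (X - z)⁺` in terms of the mean and the variance of `X`. -/
lemma integral_max_sub_le {Ω : Type*} [MeasurableSpace Ω] {P : Measure Ω} [IsProbabilityMeasure P]
    {X : Ω → ℝ} (hX : MemLp X 2 P) (z : ℝ) :
    ∫ ω, max (X ω - z) 0 ∂P ≤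
      ((∫ ω, X ω ∂P - z) + Real.sqrt ((∫ ω, X ω ∂P - z) ^ 2 + variance X P)) / 2 := by
  have hi : Integrable X P := hX.integrable (by norm_num)
  have hY : MemLp (fun ω => X ω - z) 2 P := hX.sub (memLp_const z)
  have hYi : Integrable (fun ω => X ω - z) P := hY.integrable (by norm_num)
  have hYe : ∫ ω, (X ω - z) ∂P = ∫ ω, X ω ∂P - z := by
    rw [integral_sub hi (integrable_const z)]; simp
  have hvar : variance (fun ω => X ω - z) P = variance X P := variance_sub_const hX.1 z
  have h1 : ∫ ω, (X ω - z) ^ 2 ∂P = (∫ ω, X ω ∂P - z) ^ 2 + variance X P := by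
    have := variance_eq_sub hY
    rw [hvar, hYe] at this
    simp only [Pi.pow_apply] at this
    linarith
  have h2 : ∫ ω, |X ω - z| ∂P ≤ Real.sqrt ((∫ ω, X ω ∂P - z) ^ 2 + variance X P) := by
    refine Real.le_sqrt_of_sq_le ?_
    have h3 := variance_eq_sub (X := fun ω => |X ω - z|) (μ := P) hY.norm
    have h4 := variance_nonneg (fun ω => |X ω - z|) P
    simp only [Pi.pow_apply, sq_abs] at h3
    linarith
  have h5 : ∀ ω, max (X ω - z) 0 = ((X ω - z) + |X ω - z|) / 2 := fun ω => by
    rcases le_total 0 (X ω - z) with h | h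
    · rw [max_eq_left h, abs_of_nonneg h]; ring
    · rw [max_eq_right h, abs_of_nonpos h]; ring
  simp_rw [h5]
  rw [integral_div, integral_add hYi hYi.abs, hYe]
  linarith

lemma boundObjective_eq (S : Finset (Fin m)) (π e v : Fin m → ℝ) (z : ℝ) :
    boundObjective S π e v z =
      z + ∑ j ∈ S, π j * (((e j - z) + Real.sqrt ((e j - z) ^ 2 + v j)) / 2) := by
  rw [boundObjective, add_assoc, ← Finset.sum_add_distrib]
  congr 1
  exact Finset.sum_congr rfl fun j _ => by ring

/-- The mean of the largest selected delay is at most every value of the objective. Only the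
independence of each single delay from the selection of its own node is needed. -/
theorem integral_maxDelay_le {Ω : Type*} [MeasurableSpace Ω] {P : Measure Ω}
    [IsProbabilityMeasure P] {S : Finset (Fin m)} {π : Fin m → ℝ}
    {N : Ω → Finset (Fin m)} {Q : Ω → Fin m → ℝ} (mN : Measurable N) (mQ : Measurable Q)
    (hN : ∀ᵐ ω ∂P, N ω ⊆ S ∧ (N ω).Nonempty) (hπ : ∀ j, P.real {ω | j ∈ N ω} = π j)
    (hind : ∀ j, IndepFun (fun ω => Q ω j) (fun ω => j ∈ N ω) P)
    (hQ : ∀ j, MemLp (fun ω => Q ω j) 2 P) (z : ℝ) :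
    ∫ ω, maxDelay (N ω) (Q ω) ∂P ≤
      boundObjective S π (fun j => ∫ ω, Q ω j ∂P) (fun j => variance (fun ω => Q ω j) P) z := by
  have hQ1 : ∀ j, Integrable (fun ω => Q ω j) P := fun j => (hQ j).integrable (by norm_num)
  have hs : ∀ j, MeasurableSet {ω | j ∈ N ω} := fun j =>
    mN (MeasurableSet.of_discrete (s := {A : Finset (Fin m) | j ∈ A}))
  have hpos : ∀ j, Integrable (fun ω => max (Q ω j - z) 0) P := fun j =>
    ((hQ1 j).sub (integrable_const z)).pos_part
  have hind' : ∀ j, IndepFun (fun ω => max (Q ω j - z) 0)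
      ({ω | j ∈ N ω}.indicator (1 : Ω → ℝ)) P := fun j => by
    classical
    have h2 : Measurable fun p : Prop => if p then (1 : ℝ) else 0 := measurable_from_top
    have h1 : Measurable fun x : ℝ => max (x - z) 0 := by fun_prop
    have h := (hind j).comp h1 h2
    have e : ({ω | j ∈ N ω}.indicator (1 : Ω → ℝ)) =
        (fun p : Prop => if p then (1 : ℝ) else 0) ∘ fun ω => j ∈ N ω := by
      ext ω
      simp [Set.indicator_apply]
    rw [e]
    exact h
  have hone : ∀ j, Integrable ({ω | j ∈ N ω}.indicator (1 : Ω → ℝ)) P := fun j =>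
    (integrable_const (1 : ℝ)).indicator (hs j)
  have hterm : ∀ j, Integrable
      (fun ω => max (Q ω j - z) 0 * {ω | j ∈ N ω}.indicator (1 : Ω → ℝ) ω) P := fun j =>
    (hind' j).integrable_mul (hpos j) (hone j)
  have hval : ∀ j, ∫ ω, max (Q ω j - z) 0 * {ω | j ∈ N ω}.indicator (1 : Ω → ℝ) ω ∂P =
      (∫ ω, max (Q ω j - z) 0 ∂P) * π j := fun j => by
    rw [← hπ j, ← integral_indicator_one (hs j)]
    exact (hind' j).integral_mul_eq_mul_integral (hpos j).aestronglyMeasurable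
      (hone j).aestronglyMeasurable
  have hle : ∫ ω, maxDelay (N ω) (Q ω) ∂P ≤
      ∫ ω, (z + ∑ j ∈ S, max (Q ω j - z) 0 * {ω | j ∈ N ω}.indicator (1 : Ω → ℝ) ω) ∂P := by
    refine integral_mono_ae (integrable_maxDelay mN mQ hQ1)
      ((integrable_const z).add (integrable_finsetSum S fun j _ => hterm j)) ?_
    filter_upwards [hN] with ω hω
    refine (maxDelay_le hω.2 (Q ω) z).trans (add_le_add le_rfl ?_)
    refine (Finset.sum_le_sum fun j hj => ?_).trans
      (Finset.sum_le_sum_of_subset_of_nonneg hω.1 fun j _ _ => ?_)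
    · simp [hj]
    · exact mul_nonneg (le_max_right _ _) (Set.indicator_nonneg (fun _ _ => zero_le_one) _)
  refine hle.trans ?_
  rw [integral_add (integrable_const z) (integrable_finsetSum S fun j _ => hterm j),
    integral_finsetSum S fun j _ => hterm j, boundObjective_eq]
  simp only [integral_const, probReal_univ, one_smul, hval]
  refine add_le_add le_rfl (Finset.sum_le_sum fun j _ => ?_)
  have : 0 ≤ π j := by rw [← hπ j]; exact measureReal_nonneg
  rw [mul_comm]
  exact mul_le_mul_of_nonneg_left (integral_max_sub_le (hQ j) z) this

section Objective

variable {S : Finset (Fin m)} {π e v : Fin m → ℝ}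

lemma le_boundObjective (hπ : ∀ j, 0 ≤ π j) (hv : ∀ j, 0 ≤ v j) (z : ℝ) :
    z + ∑ j ∈ S, π j * max (e j - z) 0 ≤ boundObjective S π e v z := by
  rw [boundObjective_eq]
  gcongr with j hj
  · exact hπ j
  · have h1 : |e j - z| ≤ Real.sqrt ((e j - z) ^ 2 + v j) :=
      Real.le_sqrt_of_sq_le (by rw [sq_abs]; linarith [hv j])
    have h2 := le_abs_self (e j - z)
    have h3 := neg_abs_le (e j - z)
    refine max_le ?_ ?_ <;> linarith

lemma sum_mul_sub_le_boundObjective (hπ : ∀ j, 0 ≤ π j) (hv : ∀ j, 0 ≤ v j) (z : ℝ) :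
    ∑ j ∈ S, π j * e j - (∑ j ∈ S, π j - 1) * z ≤ boundObjective S π e v z := by
  refine le_trans ?_ (le_boundObjective hπ hv z)
  have h : ∑ j ∈ S, π j * (e j - z) ≤ ∑ j ∈ S, π j * max (e j - z) 0 :=
    Finset.sum_le_sum fun j _ => mul_le_mul_of_nonneg_left (le_max_left _ _) (hπ j)
  simp_rw [mul_sub, Finset.sum_sub_distrib, ← Finset.sum_mul] at h
  linarith

lemma self_le_boundObjective (hπ : ∀ j, 0 ≤ π j) (hv : ∀ j, 0 ≤ v j) (z : ℝ) :
    z ≤ boundObjective S π e v z := by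
  refine le_trans ?_ (le_boundObjective hπ hv z)
  have : 0 ≤ ∑ j ∈ S, π j * max (e j - z) 0 :=
    Finset.sum_nonneg fun j _ => mul_nonneg (hπ j) (le_max_right _ _)
  linarith

lemma bddBelow_boundObjective (hπ : ∀ j, 0 ≤ π j) (hv : ∀ j, 0 ≤ v j) (h1 : 1 ≤ ∑ j ∈ S, π j) :
    BddBelow (Set.range (boundObjective S π e v)) := by
  refine ⟨min 0 (∑ j ∈ S, π j * e j), ?_⟩
  rintro _ ⟨z, rfl⟩
  rcases le_total 0 z with hz | hz
  · exact (min_le_left _ _).trans (hz.trans (self_le_boundObjective hπ hv z))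
  · refine (min_le_right _ _).trans (le_trans ?_ (sum_mul_sub_le_boundObjective hπ hv z))
    nlinarith

lemma continuous_boundObjective : Continuous (boundObjective S π e v) := by
  unfold boundObjective
  fun_prop

lemma exists_isMinOn_boundObjective (hπ : ∀ j, 0 ≤ π j) (hv : ∀ j, 0 ≤ v j)
    (h2 : 2 ≤ ∑ j ∈ S, π j) :
    ∃ z₀, IsMinOn (boundObjective S π e v) Set.univ z₀ := by
  have hlim : Filter.Tendsto (boundObjective S π e v) (Filter.cocompact ℝ) Filter.atTop := by
    refine Filter.tendsto_atTop_mono (f := fun z => ‖z‖ - |∑ j ∈ S, π j * e j|) (fun z => ?_)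
      (Filter.tendsto_atTop_add_const_right _ _ (tendsto_norm_cocompact_atTop (E := ℝ)))
    rw [Real.norm_eq_abs]
    rcases le_total 0 z with hz | hz
    · have := self_le_boundObjective (S := S) (e := e) hπ hv z
      rw [abs_of_nonneg hz]
      linarith [abs_nonneg (∑ j ∈ S, π j * e j)]
    · have := sum_mul_sub_le_boundObjective (S := S) (e := e) hπ hv z
      have h3 := neg_abs_le (∑ j ∈ S, π j * e j)
      rw [abs_of_nonpos hz]
      nlinarith
  obtain ⟨z₀, hz₀⟩ := continuous_boundObjective.exists_forall_le hlim
  exact ⟨z₀, fun z _ => hz₀ z⟩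

lemma latencyBound_eq_of_isMinOn {z₀ : ℝ} (h : IsMinOn (boundObjective S π e v) Set.univ z₀) :
    latencyBound S π e v = boundObjective S π e v z₀ := by
  have hle : ∀ z, boundObjective S π e v z₀ ≤ boundObjective S π e v z :=
    fun z => h (Set.mem_univ z)
  exact le_antisymm (ciInf_le ⟨_, by rintro _ ⟨z, rfl⟩; exact hle z⟩ z₀) (le_ciInf hle)

/-- If a single node is selected, the bound is the mean delay at that node. The infimum is
approached as `z → -∞`. -/
lemma latencyBound_eq_of_sum_eq_one (hπ : ∀ j, 0 ≤ π j) (hv : ∀ j, 0 ≤ v j)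
    (h1 : ∑ j ∈ S, π j = 1) : latencyBound S π e v = ∑ j ∈ S, π j * e j := by
  have hbdd := bddBelow_boundObjective (S := S) (e := e) hπ hv h1.ge
  refine le_antisymm ?_ (le_ciInf fun z => ?_)
  · have hle : ∀ R : ℝ, 0 < R → latencyBound S π e v ≤
        ∑ j ∈ S, π j * e j + (∑ j ∈ S, π j * v j / 4) * R⁻¹ := by
      intro R hR
      set z := -R - ∑ j ∈ S, |e j| with hz
      refine (ciInf_le hbdd z).trans ?_
      have hterm : ∀ j ∈ S, π j * (((e j - z) + Real.sqrt ((e j - z) ^ 2 + v j)) / 2) ≤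
          π j * (e j - z) + π j * v j / 4 * R⁻¹ := by
        intro j hj
        have hR' : R ≤ e j - z := by
          have := Finset.single_le_sum (f := fun j => |e j|) (fun _ _ => abs_nonneg _) hj
          have := neg_abs_le (e j)
          simp only [hz]
          linarith
        have hs : Real.sqrt ((e j - z) ^ 2 + v j) ≤ (e j - z) + v j / 2 * R⁻¹ := by
          have hRR : R * R⁻¹ = 1 := mul_inv_cancel₀ hR.ne'
          have hi : 0 < R⁻¹ := inv_pos.2 hR
          have hvR : 0 ≤ v j * R⁻¹ := mul_nonneg (hv j) hi.le
          refine Real.sqrt_le_iff.2 ⟨by linarith, ?_⟩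
          have : v j ≤ (e j - z) * (v j * R⁻¹) := by
            calc v j = R * (v j * R⁻¹) := by rw [mul_left_comm, hRR, mul_one]
              _ ≤ _ := mul_le_mul_of_nonneg_right hR' hvR
          nlinarith [sq_nonneg (v j / 2 * R⁻¹)]
        have := mul_le_mul_of_nonneg_left hs (hπ j)
        linarith
      rw [boundObjective_eq]
      have := Finset.sum_le_sum hterm
      simp_rw [Finset.sum_add_distrib, mul_sub, Finset.sum_sub_distrib, ← Finset.sum_mul] at this
      rw [h1] at this
      linarith
    have hlim : Filter.Tendsto (fun R : ℝ => ∑ j ∈ S, π j * e j + (∑ j ∈ S, π j * v j / 4) * R⁻¹)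
        Filter.atTop (nhds (∑ j ∈ S, π j * e j)) := by
      simpa using (tendsto_inv_atTop_zero.const_mul (∑ j ∈ S, π j * v j / 4)).const_add
        (∑ j ∈ S, π j * e j)
    exact ge_of_tendsto hlim ((Filter.eventually_gt_atTop 0).mono hle)
  · have := sum_mul_sub_le_boundObjective (S := S) (e := e) hπ hv z
    rw [h1] at this
    linarith

/-- Probability of the upper value of the law on two points at equal distance from `z` that has
mean `e` and variance `v` (the value `1 / 2` if the two points coincide). -/
noncomputable def upperProb (e v z : ℝ) : ℝ := (1 + (e - z) / Real.sqrt ((e - z) ^ 2 + v)) / 2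

/-- First-order condition at a minimiser of the objective. -/
lemma sum_mul_upperProb_eq_one (hπ : ∀ j, 0 ≤ π j) (hv : ∀ j, 0 < π j → 0 < v j) {z₀ : ℝ}
    (h : IsMinOn (boundObjective S π e v) Set.univ z₀) :
    ∑ j ∈ S, π j * upperProb (e j) (v j) z₀ = 1 := by
  have hder : HasDerivAt (boundObjective S π e v)
      (1 + ∑ j ∈ S, -(π j * upperProb (e j) (v j) z₀)) z₀ := by
    rw [show boundObjective S π e v = fun z => _ from funext (boundObjective_eq S π e v)]
    refine (hasDerivAt_id z₀).add (HasDerivAt.fun_sum fun j _ => ?_)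
    rcases (hπ j).eq_or_lt with h0 | h0
    · simp only [← h0, zero_mul, neg_zero]
      exact hasDerivAt_const _ _
    · have hp : 0 < (e j - z₀) ^ 2 + v j := by have := hv j h0; positivity
      have hd : HasDerivAt (fun z => e j - z) (-1) z₀ := (hasDerivAt_id z₀).const_sub _
      have hq := ((hd.fun_pow 2).add_const (v j)).sqrt hp.ne'
      refine (((hd.add hq).div_const 2).const_mul (π j)).congr_deriv ?_
      have := Real.sqrt_pos.2 hp
      simp only [upperProb]
      field_simp
      ring
  have hmin : IsLocalMin (boundObjective S π e v) z₀ := h.isLocalMin Filter.univ_mem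
  have := hmin.hasDerivAt_eq_zero hder
  rw [Finset.sum_neg_distrib] at this
  linarith

lemma upperProb_mem_Icc {e v z : ℝ} (hv : 0 ≤ v) : upperProb e v z ∈ Set.Icc (0 : ℝ) 1 := by
  have h1 : |e - z| ≤ Real.sqrt ((e - z) ^ 2 + v) :=
    Real.le_sqrt_of_sq_le (by rw [sq_abs]; linarith)
  have h2 : |(e - z) / Real.sqrt ((e - z) ^ 2 + v)| ≤ 1 := by
    rw [abs_div, abs_of_nonneg (Real.sqrt_nonneg _)]
    exact div_le_one_of_le₀ h1 (Real.sqrt_nonneg _)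
  obtain ⟨h3, h4⟩ := abs_le.1 h2
  unfold upperProb
  constructor <;> linarith

end Objective

end Bound

/-! ### Mean latency, and tightness for a given dispatch law -/

section Conditioning

variable {Ω α β : Type*} [MeasurableSpace Ω] [MeasurableSpace α] [MeasurableSpace β]
  {P : Measure Ω} {X : Ω → α} {Y : Ω → β}

lemma cond_preimage_inter (mY : Measurable Y) (h : IndepFun X Y P) {t : Set β}
    (ht : MeasurableSet t) {s : Set α} {u : Set β} (hs : MeasurableSet s) (hu : MeasurableSet u) :
    ProbabilityTheory.cond P (Y ⁻¹' t) (X ⁻¹' s ∩ Y ⁻¹' u) =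
      P (X ⁻¹' s) * ProbabilityTheory.cond P (Y ⁻¹' t) (Y ⁻¹' u) := by
  rw [cond_apply (mY ht), cond_apply (mY ht), Set.inter_left_comm, ← Set.preimage_inter,
    h.measure_inter_preimage_eq_mul _ _ hs (ht.inter hu), mul_left_comm]

/-- Conditioning on an event of `Y` does not change the law of a variable independent of `Y`. -/
lemma map_cond_of_indepFun [IsProbabilityMeasure P] (mX : Measurable X)
    (mY : Measurable Y) (h : IndepFun X Y P)
    {t : Set β} (ht : MeasurableSet t) (h0 : P (Y ⁻¹' t) ≠ 0) :
    (ProbabilityTheory.cond P (Y ⁻¹' t)).map X = P.map X := by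
  have := cond_isProbabilityMeasure h0
  ext s hs
  rw [Measure.map_apply mX hs, Measure.map_apply mX hs]
  simpa using cond_preimage_inter mY h ht hs MeasurableSet.univ

lemma indepFun_cond_of_indepFun [IsProbabilityMeasure P] (mX : Measurable X)
    (mY : Measurable Y) (h : IndepFun X Y P)
    {t : Set β} (ht : MeasurableSet t) (h0 : P (Y ⁻¹' t) ≠ 0) :
    IndepFun X Y (ProbabilityTheory.cond P (Y ⁻¹' t)) := by
  rw [indepFun_iff_measure_inter_preimage_eq_mul]
  intro s u hs hu
  rw [cond_preimage_inter mY h ht hs hu, ← Measure.map_apply mX hs, ← Measure.map_apply mX hs,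
    map_cond_of_indepFun mX mY h ht h0]

end Conditioning

lemma measurable_mem_finset {m : ℕ} (j : Fin m) :
    Measurable fun A : Finset (Fin m) => j ∈ A := Measurable.of_discrete

namespace StorageSystem

variable {r m : ℕ} {sys : StorageSystem r m}

/-- Conditioning on the requested file changes the law of the selected set to the dispatch law of
that file and leaves the law of the delays as it is. -/
theorem SteadyState.latency_le {Ω : Type*} [MeasurableSpace Ω] {P : Measure Ω}
    [IsProbabilityMeasure P] (st : sys.SteadyState P) (hstable : ∀ j, sys.intensity j < 1)
    {i : Fin r} (hi : 0 < sys.rate i) (hcache : sys.d i < sys.k i) (n : ℕ) :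
    Integrable (st.latency n) (ProbabilityTheory.cond P {ω | st.file n ω = i}) ∧
      ∫ ω, st.latency n ω ∂(ProbabilityTheory.cond P {ω | st.file n ω = i}) ≤
        latencyBound (sys.placement i) (sys.selProb i) sys.delayMean sys.delayVar := by
  have hpos := totalRate_pos hi
  have mY := st.measurable_marks n
  have mX := st.measurable_delay n
  have hind := st.indepFun_delay_marks hpos n
  set t : Set (Fin r × Finset (Fin m)) := {p | p.1 = i} with ht
  have hF : {ω | st.file n ω = i} = (fun ω => (st.file n ω, st.nodes n ω)) ⁻¹' t := rfl
  have hFm : MeasurableSet {ω | st.file n ω = i} := by rw [hF]; exact mY MeasurableSet.of_discrete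
  have hFr : P.real {ω | st.file n ω = i} = sys.rate i / sys.totalRate := by
    rw [hF, ← map_measureReal_apply mY MeasurableSet.of_discrete, st.map_marks hpos,
      markLaw_real_file hpos]
  have hF0 : P {ω | st.file n ω = i} ≠ 0 := fun h => by
    rw [measureReal_def, h] at hFr
    exact (div_pos hi hpos).ne hFr
  have := cond_isProbabilityMeasure hF0
  set μ := ProbabilityTheory.cond P {ω | st.file n ω = i} with hμ
  have hmap : μ.map (st.delay n) = P.map (st.delay n) :=
    map_cond_of_indepFun (t := t) mX mY hind MeasurableSet.of_discrete hF0
  have hindμ : IndepFun (st.delay n) (fun ω => (st.file n ω, st.nodes n ω)) μ :=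
    indepFun_cond_of_indepFun (t := t) mX mY hind MeasurableSet.of_discrete hF0
  have hid : ∀ j, IdentDistrib (fun ω => st.delay n ω j) (fun ω => st.delay n ω j) μ P := fun j =>
    (IdentDistrib.mk mX.aemeasurable mX.aemeasurable hmap).comp (measurable_pi_apply j)
  have hmom := st.delay_moments hpos hstable n
  have hLp : ∀ j, MemLp (fun ω => st.delay n ω j) 2 μ := fun j =>
    (hid j).symm.memLp_snd (hmom j).1
  refine ⟨integrable_maxDelay (st.measurable_nodes n) mX fun j => (hLp j).integrable (by norm_num),
    le_ciInf fun z => ?_⟩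
  have hN : ∀ᵐ ω ∂μ, st.nodes n ω ⊆ sys.placement i ∧ (st.nodes n ω).Nonempty := by
    have h1 := ae_markLaw (sys := sys)
    rw [← st.map_marks hpos n] at h1
    have h2 := (cond_absolutelyContinuous (s := {ω | st.file n ω = i})).ae_le
      (ae_of_ae_map mY.aemeasurable h1)
    filter_upwards [h2, ae_cond_mem hFm] with ω h3 h4
    have h4 : st.file n ω = i := h4
    rw [h4] at h3
    refine ⟨h3.1, Finset.card_pos.1 ?_⟩
    rw [h3.2]
    omega
  have hπ : ∀ j, μ.real {ω | j ∈ st.nodes n ω} = sys.selProb i j := fun j => by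
    have h1 : P.real ({ω | st.file n ω = i} ∩ {ω | j ∈ st.nodes n ω}) =
        sys.rate i / sys.totalRate * sys.selProb i j := by
      rw [← markLaw_real_file_node hpos, ← st.map_marks hpos n,
        map_measureReal_apply mY MeasurableSet.of_discrete]
      rfl
    rw [hμ, measureReal_def, cond_apply hFm, ENNReal.toReal_mul, ENNReal.toReal_inv,
      ← measureReal_def, ← measureReal_def, h1, hFr]
    have := (div_pos hi hpos).ne'
    field_simp
  have hle := integral_maxDelay_le (st.measurable_nodes n) mX hN hπ
    (fun j => hindμ.comp (measurable_pi_apply j)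
      ((measurable_mem_finset j).comp measurable_snd)) hLp z
  have e1 : (fun j => ∫ ω, st.delay n ω j ∂μ) = sys.delayMean := by
    ext j
    rw [(hid j).integral_eq, (hmom j).2.1]
  have e2 : (fun j => variance (fun ω => st.delay n ω j) μ) = sys.delayVar := by
    ext j
    rw [(hid j).variance_eq, (hmom j).2.2]
  rw [e1, e2] at hle
  exact hle

section IndependentDispatch

variable (sys) (i : Fin r) (ν : Measure (Fin m → ℝ))

/-- Law of a selected set and of delays independent of it. -/
noncomputable def dispatchProd : Measure (Finset (Fin m) × (Fin m → ℝ)) :=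
  (sys.dispatch i).toMeasure.prod ν

instance [IsProbabilityMeasure ν] : IsProbabilityMeasure (sys.dispatchProd i ν) := by
  unfold dispatchProd; infer_instance

variable {sys i ν}

lemma ae_dispatchProd : ∀ᵐ p ∂(sys.dispatchProd i ν),
    p.1 ⊆ sys.placement i ∧ p.1.card = sys.k i - sys.d i := by
  have h : ∀ᵐ A ∂(sys.dispatch i).toMeasure,
      A ⊆ sys.placement i ∧ A.card = sys.k i - sys.d i := by
    rw [ae_iff_of_countable]
    intro A hA
    rw [PMF.toMeasure_apply_singleton _ _ (measurableSet_singleton _)] at hA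
    have := (PMF.mem_support_iff _ _).2 hA
    exact ⟨sys.dispatch_subset i A this, sys.dispatch_card i A this⟩
  exact Measure.quasiMeasurePreserving_fst.ae h

lemma identDistrib_dispatchProd [IsProbabilityMeasure ν] (j : Fin m) :
    IdentDistrib (fun p => p.2 j) (fun q => q j) (sys.dispatchProd i ν) ν :=
  ⟨(by fun_prop : Measurable fun p : Finset (Fin m) × (Fin m → ℝ) => p.2 j).aemeasurable,
    (measurable_pi_apply j).aemeasurable, by
    have h : (fun p : Finset (Fin m) × (Fin m → ℝ) => p.2 j) =
      (fun q : Fin m → ℝ => q j) ∘ Prod.snd := rfl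
    rw [h, ← Measure.map_map (by fun_prop) measurable_snd, dispatchProd, Measure.map_snd_prod]
    simp⟩

lemma indepFun_dispatchProd [IsProbabilityMeasure ν] (j : Fin m) :
    IndepFun (fun p => p.2 j) (fun p => j ∈ p.1) (sys.dispatchProd i ν) :=
  (indepFun_prod (μ := (sys.dispatch i).toMeasure) (ν := ν) (measurable_mem_finset j)
    (measurable_pi_apply j)).symm

lemma dispatchProd_real_mem [IsProbabilityMeasure ν] (j : Fin m) :
    (sys.dispatchProd i ν).real {p | j ∈ p.1} = sys.selProb i j := by
  have h : {p : Finset (Fin m) × (Fin m → ℝ) | j ∈ p.1} = {A | j ∈ A} ×ˢ Set.univ := by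
    ext; simp
  rw [h, dispatchProd, measureReal_prod_prod, probReal_univ, mul_one,
    ← integral_indicator_one MeasurableSet.of_discrete, PMF.integral_eq_sum]
  refine Finset.sum_congr rfl fun A _ => ?_
  by_cases hA : j ∈ A <;> simp [hA]

lemma integral_maxDelay_dispatchProd [IsProbabilityMeasure ν] (hν : ∀ j, MemLp (fun q => q j) 2 ν) :
    Integrable (fun p => maxDelay p.1 p.2) (sys.dispatchProd i ν) ∧
    ∫ p, maxDelay p.1 p.2 ∂(sys.dispatchProd i ν) =
      ∑ A : Finset (Fin m), (sys.dispatch i A).toReal * ∫ q, maxDelay A q ∂ν := by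
  have hint : Integrable (fun p => maxDelay p.1 p.2) (sys.dispatchProd i ν) :=
    integrable_maxDelay measurable_fst measurable_snd fun j =>
      ((identDistrib_dispatchProd j).symm.memLp_snd (hν j)).integrable (by norm_num)
  refine ⟨hint, ?_⟩
  rw [dispatchProd, integral_prod _ hint, PMF.integral_eq_sum]
  rfl

/-- Delays independent of the dispatch decision obey the bound. -/
lemma sum_integral_maxDelay_le [IsProbabilityMeasure ν] (hcache : sys.d i < sys.k i)
    (hν : ∀ j, MemLp (fun q => q j) 2 ν) :
    ∑ A : Finset (Fin m), (sys.dispatch i A).toReal * ∫ q, maxDelay A q ∂ν ≤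
      latencyBound (sys.placement i) (sys.selProb i)
        (fun j => ∫ q, q j ∂ν) (fun j => variance (fun q => q j) ν) := by
  refine le_ciInf fun z => ?_
  rw [← (integral_maxDelay_dispatchProd hν).2]
  have h := integral_maxDelay_le (P := sys.dispatchProd i ν) (S := sys.placement i)
    measurable_fst measurable_snd ?_
    dispatchProd_real_mem indepFun_dispatchProd
    (fun j => (identDistrib_dispatchProd j).symm.memLp_snd (hν j)) z
  · have e1 : (fun j => ∫ p, p.2 j ∂(sys.dispatchProd i ν)) = fun j => ∫ q, q j ∂ν :=
      funext fun j => (identDistrib_dispatchProd j).integral_eq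
    have e2 : (fun j => variance (fun p => p.2 j) (sys.dispatchProd i ν)) =
        fun j => variance (fun q => q j) ν :=
      funext fun j => (identDistrib_dispatchProd j).variance_eq
    rwa [e1, e2] at h
  · filter_upwards [ae_dispatchProd] with p hp
    refine ⟨hp.1, Finset.card_pos.1 ?_⟩
    rw [hp.2]
    omega

/-- With a single selected node every law of the delays gives equality in the bound. -/
lemma sum_integral_maxDelay_eq_of_eq_one (h1 : sys.k i - sys.d i = 1) :
    ∑ A : Finset (Fin m), (sys.dispatch i A).toReal * ∫ q, maxDelay A q ∂ν =
      latencyBound (sys.placement i) (sys.selProb i)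
        (fun j => ∫ q, q j ∂ν) (fun j => variance (fun q => q j) ν) := by
  rw [latencyBound_eq_of_sum_eq_one (sys.selProb_nonneg i) (fun j => variance_nonneg _ _)
    (by rw [sum_selProb, h1, Nat.cast_one])]
  have hS : ∑ j ∈ sys.placement i, sys.selProb i j * ∫ q, q j ∂ν =
      ∑ j, sys.selProb i j * ∫ q, q j ∂ν :=
    Finset.sum_subset (Finset.subset_univ _) fun j _ hj => by rw [sys.selProb_eq_zero hj, zero_mul]
  rw [hS]
  simp_rw [selProb, Finset.sum_mul]
  rw [Finset.sum_comm]
  refine Finset.sum_congr rfl fun A _ => ?_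
  rcases sys.dispatch_eq_zero_or i A with h | h
  · simp [h]
  · rw [h1, Finset.card_eq_one] at h
    obtain ⟨a, rfl⟩ := h.2
    simp [maxDelay]

end IndependentDispatch

end StorageSystem

/-- The law with mass `p` at `x` and `1 - p` at `y`. -/
noncomputable def twoPointLaw {α : Type*} [MeasurableSpace α] (p : ℝ) (x y : α) : Measure α :=
  ENNReal.ofReal p • Measure.dirac x + ENNReal.ofReal (1 - p) • Measure.dirac y

section TwoPoint

variable {α : Type*} [MeasurableSpace α] {p : ℝ}

lemma isProbabilityMeasure_twoPointLaw (hp : p ∈ Set.Icc (0 : ℝ) 1) (x y : α) :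
    IsProbabilityMeasure (twoPointLaw p x y) := by
  refine ⟨?_⟩
  simp [twoPointLaw, ← ENNReal.ofReal_add hp.1 (sub_nonneg.2 hp.2)]

variable [MeasurableSingletonClass α]

lemma integrable_twoPointLaw (x y : α) (f : α → ℝ) : Integrable f (twoPointLaw p x y) :=
  ((integrable_dirac (by simp)).smul_measure (by simp)).add_measure
    ((integrable_dirac (by simp)).smul_measure (by simp))

lemma integral_twoPointLaw (hp : p ∈ Set.Icc (0 : ℝ) 1) (x y : α) (f : α → ℝ) :
    ∫ a, f a ∂(twoPointLaw p x y) = p * f x + (1 - p) * f y := by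
  rw [twoPointLaw, integral_add_measure ((integrable_dirac (by simp)).smul_measure (by simp))
    ((integrable_dirac (by simp)).smul_measure (by simp)), integral_smul_measure,
    integral_smul_measure, integral_dirac, integral_dirac, ENNReal.toReal_ofReal hp.1,
    ENNReal.toReal_ofReal (sub_nonneg.2 hp.2), smul_eq_mul, smul_eq_mul]

lemma ae_twoPointLaw {x y : α} {q : α → Prop} (hx : q x) (hy : q y) :
    ∀ᵐ a ∂(twoPointLaw p x y), q a := by
  rw [twoPointLaw, ae_add_measure_iff]
  constructor <;> refine Measure.ae_smul_measure ?_ _ <;> rw [ae_dirac_eq] <;> assumption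

lemma memLp_two_twoPointLaw (x y : α) {f : α → ℝ} (hf : Measurable f) :
    MemLp f 2 (twoPointLaw p x y) :=
  (memLp_two_iff_integrable_sq hf.aestronglyMeasurable).2 (integrable_twoPointLaw x y _)

lemma variance_twoPointLaw (hp : p ∈ Set.Icc (0 : ℝ) 1) (x y : α) {f : α → ℝ}
    (hf : Measurable f) :
    variance f (twoPointLaw p x y) = p * (1 - p) * (f x - f y) ^ 2 := by
  have := isProbabilityMeasure_twoPointLaw hp x y
  rw [variance_eq_sub (memLp_two_twoPointLaw x y hf), integral_twoPointLaw hp,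
    integral_twoPointLaw hp, Pi.pow_apply, Pi.pow_apply]
  ring

end TwoPoint

namespace StorageSystem

variable {r m : ℕ} {sys : StorageSystem r m}

lemma maxDelay_update {A : Finset (Fin m)} (hA : 2 ≤ A.card) (l : Fin m) (z y : ℝ) :
    maxDelay A (Function.update (fun _ => z) l y) = if l ∈ A then max z y else z := by
  have hne : A.Nonempty := Finset.card_pos.1 (by omega)
  obtain ⟨b, hb, hbl⟩ := Finset.exists_mem_ne (by omega : 1 < A.card) l
  rw [maxDelay_eq hne]
  have hzb : z ≤ A.sup' hne (Function.update (fun _ => z) l y) := by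
    have := Finset.le_sup' (Function.update (fun _ => z) l y) hb
    rwa [Function.update_of_ne hbl] at this
  split_ifs with hl
  · refine le_antisymm (Finset.sup'_le _ _ fun j _ => ?_) (max_le hzb ?_)
    · by_cases h : j = l
      · rw [h, Function.update_self]; exact le_max_right _ _
      · rw [Function.update_of_ne h]; exact le_max_left _ _
    · have := Finset.le_sup' (Function.update (fun _ => z) l y) hl
      rwa [Function.update_self] at this
  · refine le_antisymm (Finset.sup'_le _ _ fun j hj => ?_) hzb
    rw [Function.update_of_ne (ne_of_mem_of_not_mem hj hl)]

/-- Tightness for the given dispatch law: the delay at `l` takes the values `0` and `2 * z`, the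
other delays are equal to `z`, and `z = (e ^ 2 + v) / (2 * e)` is forced by the moments. -/
theorem exists_delayLaw_eq (hstable : ∀ j, sys.intensity j < 1) {i : Fin r}
    (hcache : sys.d i < sys.k i) (l : Fin m) :
    ∃ ν : Measure (Fin m → ℝ), IsProbabilityMeasure ν ∧
      (∀ j, ∀ᵐ q ∂ν, 0 ≤ q j) ∧
      (∀ j, MemLp (fun q => q j) 2 ν) ∧
      ∫ q, q l ∂ν = sys.delayMean l ∧
      variance (fun q => q l) ν = sys.delayVar l ∧
      ∑ A : Finset (Fin m), (sys.dispatch i A).toReal * ∫ q, maxDelay A q ∂ν =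
        latencyBound (sys.placement i) (sys.selProb i)
          (fun j => ∫ q, q j ∂ν) (fun j => variance (fun q => q j) ν) := by
  have he := delayMean_pos hstable l
  have hv := delayVar_nonneg hstable l
  set e := sys.delayMean l
  set v := sys.delayVar l
  set z := (e ^ 2 + v) / (2 * e) with hz
  set p := e ^ 2 / (e ^ 2 + v) with hpdef
  have hev : 0 < e ^ 2 + v := by positivity
  have hz0 : 0 < z := by positivity
  have hp : p ∈ Set.Icc (0 : ℝ) 1 := ⟨by positivity, div_le_one_of_le₀ (by linarith) hev.le⟩
  have hpz : p * (2 * z) = e := by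
    rw [hpdef, hz]; field_simp
  set x : Fin m → ℝ := Function.update (fun _ => z) l (2 * z) with hx
  set y : Fin m → ℝ := Function.update (fun _ => z) l 0 with hy
  set ν := twoPointLaw p x y with hν
  have := isProbabilityMeasure_twoPointLaw hp x y
  have hLp : ∀ j, MemLp (fun q : Fin m → ℝ => q j) 2 ν := fun j =>
    memLp_two_twoPointLaw x y (measurable_pi_apply j)
  have hmean : ∫ q, q l ∂ν = e := by
    rw [hν, integral_twoPointLaw hp, hx, hy, Function.update_self, Function.update_self, hpz]
    ring
  have hvar : variance (fun q => q l) ν = v := by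
    rw [hν, variance_twoPointLaw hp x y (measurable_pi_apply l), hx, hy, Function.update_self,
      Function.update_self]
    have : p * (1 - p) * (2 * z - 0) ^ 2 = (p * (2 * z)) * (2 * z) - (p * (2 * z)) ^ 2 := by ring
    rw [this, hpz, hz]
    field_simp
    ring
  have hmean' : ∀ j, j ≠ l → ∫ q, q j ∂ν = z := fun j hj => by
    rw [hν, integral_twoPointLaw hp, hx, hy, Function.update_of_ne hj, Function.update_of_ne hj]
    ring
  have hvar' : ∀ j, j ≠ l → variance (fun q => q j) ν = 0 := fun j hj => by
    rw [hν, variance_twoPointLaw hp x y (measurable_pi_apply j), hx, hy, Function.update_of_ne hj,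
      Function.update_of_ne hj]
    ring
  refine ⟨ν, this, fun j => ae_twoPointLaw ?_ ?_, hLp, hmean, hvar, ?_⟩
  · by_cases h : j = l
    · rw [hx, h, Function.update_self]; positivity
    · rw [hx, Function.update_of_ne h]; exact hz0.le
  · by_cases h : j = l
    · rw [hy, h, Function.update_self]
    · rw [hy, Function.update_of_ne h]; exact hz0.le
  rcases (by omega : sys.k i - sys.d i = 1 ∨ 2 ≤ sys.k i - sys.d i) with h1 | h2
  · exact sum_integral_maxDelay_eq_of_eq_one h1
  refine le_antisymm (sum_integral_maxDelay_le hcache hLp) ?_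
  have hbdd : BddBelow (Set.range (boundObjective (sys.placement i) (sys.selProb i)
      (fun j => ∫ q, q j ∂ν) (fun j => variance (fun q => q j) ν))) := by
    refine bddBelow_boundObjective (sys.selProb_nonneg i) (fun j => variance_nonneg _ _) ?_
    rw [sum_selProb]
    exact_mod_cast (by omega : 1 ≤ sys.k i - sys.d i)
  refine (ciInf_le hbdd z).trans (le_of_eq ?_)
  have hsum : ∀ A : Finset (Fin m), (sys.dispatch i A).toReal * ∫ q, maxDelay A q ∂ν =
      (sys.dispatch i A).toReal * z +
        (if l ∈ A then (sys.dispatch i A).toReal else 0) * (e / 2) := fun A => by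
    rcases sys.dispatch_eq_zero_or i A with h | h
    · simp [h]
    · rw [hν, integral_twoPointLaw hp, hx, hy, maxDelay_update (by omega),
        maxDelay_update (by omega), max_eq_right (by linarith), max_eq_left hz0.le]
      split_ifs
      · linear_combination (sys.dispatch i A).toReal * hpz / 2
      · ring
  have hobj : ∀ j, sys.selProb i j * (((∫ q, q j ∂ν - z) +
      Real.sqrt ((∫ q, q j ∂ν - z) ^ 2 + variance (fun q => q j) ν)) / 2) =
      if j = l then sys.selProb i l * (e / 2) else 0 := fun j => by
    split_ifs with h
    · rw [h, hmean, hvar]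
      have : (e - z) ^ 2 + v = z ^ 2 := by
        rw [hz]; field_simp; ring
      rw [this, Real.sqrt_sq hz0.le]
      ring
    · rw [hmean' j h, hvar' j h]
      simp
  rw [boundObjective_eq]
  simp only [hobj, hsum]
  rw [Finset.sum_add_distrib, ← Finset.sum_mul, ← Finset.sum_mul, sum_dispatch, one_mul,
    Finset.sum_ite_eq']
  split_ifs with hl
  · rfl
  · rw [← selProb, sys.selProb_eq_zero hl, zero_mul]

end StorageSystem

/-! ### Random subsets with a marked element -/

section Selection

variable {m : ℕ}

/-- A random `K`-subset with a marked element, with prescribed inclusion probabilities `π` and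
marking probabilities `ρ`. Birkhoff's theorem is applied to the doubly stochastic matrix whose row
`0` is `ρ`, whose rows `1, …, K - 1` share `π - ρ` equally and whose other rows share `1 - π`
equally: a permutation marks the image of `0` and selects the images of `0, …, K - 1`. -/
theorem exists_marked_selection {K : ℕ} (hK : 2 ≤ K) {π ρ : Fin m → ℝ} (hρ : ∀ j, 0 ≤ ρ j)
    (hρπ : ∀ j, ρ j ≤ π j) (hπ : ∀ j, π j ≤ 1) (hsρ : ∑ j, ρ j = 1) (hsπ : ∑ j, π j = K) :
    ∃ (w : Equiv.Perm (Fin m) → ℝ) (A : Equiv.Perm (Fin m) → Finset (Fin m))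
      (J : Equiv.Perm (Fin m) → Fin m), (∀ σ, 0 ≤ w σ) ∧ ∑ σ, w σ = 1 ∧ (∀ σ, J σ ∈ A σ) ∧
        (∀ σ, (A σ).card = K) ∧ (∀ j, ∑ σ, (if J σ = j then w σ else 0) = ρ j) ∧
        ∀ j, ∑ σ, (if j ∈ A σ then w σ else 0) = π j := by
  have hKm : K ≤ m := by
    have h : ∑ j, π j ≤ ∑ _j : Fin m, (1 : ℝ) := Finset.sum_le_sum fun j _ => hπ j
    rw [hsπ] at h
    simpa using h
  have hK1 : (0 : ℝ) < (K : ℝ) - 1 := by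
    have : (2 : ℝ) ≤ K := by exact_mod_cast hK
    linarith
  have hmK : (0 : ℝ) ≤ (m : ℝ) - K := sub_nonneg.2 (by exact_mod_cast hKm)
  set f : Fin m → ℕ → ℝ := fun j t =>
    if t = 0 then ρ j else if t < K then (π j - ρ j) / ((K : ℝ) - 1)
      else (1 - π j) / ((m : ℝ) - K) with hf
  have hf_nonneg : ∀ j t, 0 ≤ f j t := fun j t => by
    simp only [hf]
    split_ifs
    · exact hρ j
    · exact div_nonneg (sub_nonneg.2 (hρπ j)) hK1.le
    · exact div_nonneg (sub_nonneg.2 (hπ j)) hmK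
  have hlow : ∀ j, ∑ t ∈ Finset.range K, f j t = π j := by
    intro j
    obtain ⟨L, rfl⟩ : ∃ L, K = L + 1 := ⟨K - 1, by omega⟩
    rw [Finset.sum_range_succ']
    have : ∀ t ∈ Finset.range L, f j (t + 1) = (π j - ρ j) / (((L + 1 : ℕ) : ℝ) - 1) := by
      intro t ht
      have := Finset.mem_range.1 ht
      simp only [hf]
      rw [if_neg (by omega), if_pos (by omega)]
    rw [Finset.sum_congr rfl this]
    have hL : (L : ℝ) ≠ 0 := by
      have : L ≠ 0 := by omega
      exact_mod_cast this
    simp only [Finset.sum_const, Finset.card_range, nsmul_eq_mul, hf, if_true]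
    push_cast
    rw [add_sub_cancel_right]
    field_simp
    ring
  have hcol : ∀ j, ∑ t ∈ Finset.range m, f j t = 1 := by
    intro j
    rw [← Finset.sum_range_add_sum_Ico _ hKm, hlow]
    have : ∀ t ∈ Finset.Ico K m, f j t = (1 - π j) / ((m : ℝ) - K) := by
      intro t ht
      have := Finset.mem_Ico.1 ht
      simp only [hf]
      rw [if_neg (by omega), if_neg (by omega)]
    rw [Finset.sum_congr rfl this, Finset.sum_const, Nat.card_Ico, nsmul_eq_mul,
      Nat.cast_sub hKm]
    rcases hmK.eq_or_lt with h0 | h0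
    · -- every node is selected, so all inclusion probabilities are equal to one
      have h1 : ∑ j, (1 - π j) = 0 := by
        rw [Finset.sum_sub_distrib, hsπ]
        simpa using h0.symm
      have h2 := (Finset.sum_eq_zero_iff_of_nonneg fun j _ => sub_nonneg.2 (hπ j)).1 h1 j
        (Finset.mem_univ j)
      rw [← h0]
      linarith
    · rw [mul_div_cancel₀ _ h0.ne']
      ring
  have hrow : ∀ t, t < m → ∑ j, f j t = 1 := by
    intro t ht
    simp only [hf]
    by_cases h0 : t = 0
    · simpa [h0] using hsρ
    by_cases h1 : t < K
    · simp only [h0, h1, if_true, if_false]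
      rw [← Finset.sum_div, Finset.sum_sub_distrib, hsπ, hsρ, div_self hK1.ne']
    · simp only [h0, h1, if_false]
      have : (0 : ℝ) < (m : ℝ) - K := sub_pos.2 (by exact_mod_cast (by omega : K < m))
      rw [← Finset.sum_div, Finset.sum_sub_distrib, hsπ]
      simpa using div_self this.ne'
  have hM : (Matrix.of fun t j : Fin m => f j t) ∈ doublyStochastic ℝ (Fin m) := by
    rw [mem_doublyStochastic_iff_sum]
    refine ⟨fun t j => hf_nonneg j t, fun t => hrow t t.2, fun j => ?_⟩
    have := Fin.sum_univ_eq_sum_range (f j) m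
    rw [hcol] at this
    exact this
  obtain ⟨w, hw0, hw1, hw⟩ := exists_eq_sum_perm_of_mem_doublyStochastic hM
  have hmarg : ∀ t j : Fin m, ∑ σ, (if σ t = j then w σ else 0) = f j t := fun t j => by
    have := congrFun (congrFun hw t) j
    rw [Matrix.of_apply] at this
    rw [← this, Matrix.sum_apply]
    refine Finset.sum_congr rfl fun σ _ => ?_
    simp [Equiv.Perm.permMatrix, PEquiv.toMatrix_apply, Equiv.toPEquiv_apply, eq_comm]
  have hm0 : 0 < m := by omega
  set low : Finset (Fin m) := Finset.univ.filter fun t : Fin m => (t : ℕ) < K with hlowdef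
  refine ⟨w, fun σ => low.image σ, fun σ => σ ⟨0, hm0⟩, hw0, hw1, fun σ => ?_, fun σ => ?_,
    fun j => ?_, fun j => ?_⟩
  · exact Finset.mem_image_of_mem _ (Finset.mem_filter.2 ⟨Finset.mem_univ _, by simp; omega⟩)
  · rw [Finset.card_image_of_injective _ σ.injective, hlowdef, Fin.card_filter_val_lt]
    omega
  · rw [hmarg]
    simp [hf]
  · have h1 : ∀ σ : Equiv.Perm (Fin m), (if j ∈ low.image σ then w σ else 0) =
        ∑ t ∈ low, if σ t = j then w σ else 0 := fun σ => by
      have h2 : ∀ t, σ t = j ↔ t = σ.symm j := fun t => by rw [Equiv.eq_symm_apply]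
      have h3 : j ∈ low.image σ ↔ σ.symm j ∈ low := by
        simp only [Finset.mem_image, h2, exists_eq_right]
      simp only [h2, Finset.sum_ite_eq', h3]
    simp_rw [h1]
    rw [Finset.sum_comm]
    simp_rw [hmarg]
    rw [← hlow j, hlowdef, Finset.sum_filter,
      Fin.sum_univ_eq_sum_range (fun t => if t < K then f j t else 0) m, ← Finset.sum_filter]
    refine Finset.sum_congr ?_ fun _ _ => rfl
    ext t
    simp only [Finset.mem_filter, Finset.mem_range]
    omega

end Selection

/-! ### Tightness for given selection probabilities -/

/-- A variable is independent of a proposition-valued variable if its law is not changed by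
conditioning on the proposition or on its negation. -/
lemma indepFun_prop_of_measure_inter {Ω α : Type*} [MeasurableSpace Ω] [MeasurableSpace α]
    {η : Measure Ω} {X : Ω → α} {B : Set Ω} {p : ENNReal} {p' : ENNReal} {τ : Measure α}
    (hB : MeasurableSet B) (hpp : p + p' = 1) (hτ : τ Set.univ = 1)
    (h1 : ∀ s, MeasurableSet s → η (X ⁻¹' s ∩ B) = p * τ s)
    (h2 : ∀ s, MeasurableSet s → η (X ⁻¹' s ∩ Bᶜ) = p' * τ s) :
    (∀ s, MeasurableSet s → η (X ⁻¹' s) = τ s) ∧ IndepFun X (fun ω => ω ∈ B) η := by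
  have hX : ∀ s, MeasurableSet s → η (X ⁻¹' s) = τ s := fun s hs => by
    rw [← measure_inter_add_sdiff (X ⁻¹' s) hB, Set.sdiff_eq, h1 s hs, h2 s hs, ← add_mul, hpp,
      one_mul]
  have hBp : η B = p := by simpa [hτ] using h1 _ MeasurableSet.univ
  have hBp' : η Bᶜ = p' := by simpa [hτ] using h2 _ MeasurableSet.univ
  have huniv : η Set.univ = 1 := by simpa [hτ] using hX _ MeasurableSet.univ
  refine ⟨hX, ?_⟩
  rw [indepFun_iff_measure_inter_preimage_eq_mul]
  intro s t hs _
  rw [hX s hs]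
  -- the preimage of a set of truth values is empty, everything, the event or its complement
  by_cases hT : True ∈ t <;> by_cases hF : False ∈ t
  · have : (fun ω => ω ∈ B) ⁻¹' t = Set.univ := by
      ext ω; by_cases h : ω ∈ B <;> simp [h, hT, hF]
    rw [this, Set.inter_univ, hX s hs, huniv, mul_one]
  · have : (fun ω => ω ∈ B) ⁻¹' t = B := by
      ext ω; by_cases h : ω ∈ B <;> simp [h, hT, hF]
    rw [this, h1 s hs, hBp, mul_comm]
  · have : (fun ω => ω ∈ B) ⁻¹' t = Bᶜ := by
      ext ω; by_cases h : ω ∈ B <;> simp [h, hT, hF]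
    rw [this, h2 s hs, hBp', mul_comm]
  · have : (fun ω => ω ∈ B) ⁻¹' t = ∅ := by
      ext ω; by_cases h : ω ∈ B <;> simp [h, hT, hF]
    rw [this, Set.inter_empty, measure_empty, mul_zero]

section Coupling

variable {m : ℕ} {ι : Type*} [Fintype ι]

/-- Law of the delay at `j` when `A` is selected and `a` is marked: the upper value `z + c j` at the
marked node, the lower value `z - c j` at the other selected nodes, and the two-point law with
upper probability `p j` elsewhere. -/
noncomputable def markedDelayLaw (z : ℝ) (c p : Fin m → ℝ) (A : Finset (Fin m)) (a j : Fin m) :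
    Measure ℝ :=
  if a = j then Measure.dirac (z + c j) else
    if j ∈ A then Measure.dirac (z - c j) else twoPointLaw (p j) (z + c j) (z - c j)

/-- Joint law of the selected set and of the delays: the pair `(A s, a s)` is drawn with
weights `w`, then the delays are drawn independently from `markedDelayLaw`. -/
noncomputable def coupledLaw (w : ι → ℝ) (A : ι → Finset (Fin m)) (a : ι → Fin m) (z : ℝ)
    (c p : Fin m → ℝ) : Measure (Finset (Fin m) × (Fin m → ℝ)) :=
  ∑ s, ENNReal.ofReal (w s) •
    (Measure.dirac (A s)).prod (Measure.pi (markedDelayLaw z c p (A s) (a s)))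

variable {w : ι → ℝ} {A : ι → Finset (Fin m)} {a : ι → Fin m} {z : ℝ} {c p π : Fin m → ℝ}

lemma isProbabilityMeasure_markedDelayLaw (hp : ∀ j, p j ∈ Set.Icc (0 : ℝ) 1)
    (B : Finset (Fin m)) (b j : Fin m) : IsProbabilityMeasure (markedDelayLaw z c p B b j) := by
  have := isProbabilityMeasure_twoPointLaw (hp j) (z + c j) (z - c j)
  unfold markedDelayLaw
  split_ifs <;> infer_instance

lemma coupledLaw_apply (hp : ∀ j, p j ∈ Set.Icc (0 : ℝ) 1) (j : Fin m)
    (T : Set (Finset (Fin m))) {s : Set ℝ} (hs : MeasurableSet s) :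
    coupledLaw w A a z c p ((fun q => q.2 j) ⁻¹' s ∩ {q | q.1 ∈ T}) =
      ∑ x, ENNReal.ofReal (w x) * (T.indicator 1 (A x) * markedDelayLaw z c p (A x) (a x) j s) := by
  have := isProbabilityMeasure_markedDelayLaw (z := z) (c := c) hp
  have e : (fun q : Finset (Fin m) × (Fin m → ℝ) => q.2 j) ⁻¹' s ∩ {q | q.1 ∈ T} =
      T ×ˢ (Function.eval j ⁻¹' s) := by
    ext q
    simp [and_comm]
  rw [e, coupledLaw, Measure.finsetSum_apply]
  refine Finset.sum_congr rfl fun x _ => ?_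
  rw [Measure.smul_apply, Measure.prod_prod, smul_eq_mul,
    (measurePreserving_eval (markedDelayLaw z c p (A x) (a x)) j).measure_preimage
      hs.nullMeasurableSet, Measure.dirac_apply' _ MeasurableSet.of_discrete]

lemma isProbabilityMeasure_coupledLaw (hw : ∀ x, 0 ≤ w x) (hw1 : ∑ x, w x = 1)
    (hp : ∀ j, p j ∈ Set.Icc (0 : ℝ) 1) : IsProbabilityMeasure (coupledLaw w A a z c p) := by
  have := isProbabilityMeasure_markedDelayLaw (z := z) (c := c) hp
  refine ⟨?_⟩
  rw [coupledLaw, Measure.finsetSum_apply]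
  simp only [Measure.smul_apply, measure_univ, smul_eq_mul, mul_one]
  rw [← ENNReal.ofReal_sum_of_nonneg fun x _ => hw x, hw1, ENNReal.ofReal_one]

lemma coupledLaw_delay (hw : ∀ x, 0 ≤ w x) (hw1 : ∑ x, w x = 1)
    (hp : ∀ j, p j ∈ Set.Icc (0 : ℝ) 1) (ha : ∀ x, a x ∈ A x)
    (hmark : ∀ j, ∑ x, (if a x = j then w x else 0) = π j * p j)
    (hsel : ∀ j, ∑ x, (if j ∈ A x then w x else 0) = π j) (j : Fin m) :
    (coupledLaw w A a z c p).map (fun q => q.2 j) = twoPointLaw (p j) (z + c j) (z - c j) ∧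
      (coupledLaw w A a z c p).real {q | j ∈ q.1} = π j ∧
      IndepFun (fun q => q.2 j) (fun q => j ∈ q.1) (coupledLaw w A a z c p) := by
  have hη := isProbabilityMeasure_coupledLaw (A := A) (a := a) (z := z) (c := c) hw hw1 hp
  set η := coupledLaw w A a z c p with hηdef
  set τ := twoPointLaw (p j) (z + c j) (z - c j) with hτ
  have hτ1 := isProbabilityMeasure_twoPointLaw (hp j) (z + c j) (z - c j)
  have hπ0 : 0 ≤ π j := by
    rw [← hsel j]; exact Finset.sum_nonneg fun x _ => by split_ifs <;> simp [hw]
  have hπ1 : π j ≤ 1 := by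
    rw [← hsel j, ← hw1]; exact Finset.sum_le_sum fun x _ => by split_ifs <;> simp [hw]
  have hlow : ∑ x, (if j ∈ A x ∧ a x ≠ j then w x else 0) = π j * (1 - p j) := by
    have h : ∑ x, (if j ∈ A x then w x else 0) = ∑ x, (if a x = j then w x else 0) +
        ∑ x, (if j ∈ A x ∧ a x ≠ j then w x else 0) := by
      rw [← Finset.sum_add_distrib]
      refine Finset.sum_congr rfl fun x _ => ?_
      by_cases h1 : a x = j
      · have : j ∈ A x := h1 ▸ ha x
        simp [h1, this]
      · simp [h1]
    rw [hsel, hmark] at h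
    linarith
  have hout : ∑ x, (if j ∈ A x then 0 else w x) = 1 - π j := by
    rw [← hsel j, ← hw1, ← Finset.sum_sub_distrib]
    exact Finset.sum_congr rfl fun x _ => by split_ifs <;> simp
  have hB : MeasurableSet {q : Finset (Fin m) × (Fin m → ℝ) | j ∈ q.1} :=
    measurable_fst (MeasurableSet.of_discrete (s := {A : Finset (Fin m) | j ∈ A}))
  have h1 : ∀ s, MeasurableSet s → η ((fun q => q.2 j) ⁻¹' s ∩ {q | j ∈ q.1}) =
      ENNReal.ofReal (π j) * τ s := fun s hs => by
    have e := coupledLaw_apply (w := w) (A := A) (a := a) (z := z) (c := c) hp j {B | j ∈ B} hs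
    refine e.trans ?_
    have hx : ∀ x, ENNReal.ofReal (w x) * (({B | j ∈ B} : Set (Finset (Fin m))).indicator 1 (A x) *
        markedDelayLaw z c p (A x) (a x) j s) =
        ENNReal.ofReal (if a x = j then w x else 0) * Measure.dirac (z + c j) s +
        ENNReal.ofReal (if j ∈ A x ∧ a x ≠ j then w x else 0) * Measure.dirac (z - c j) s :=
      fun x => by
        by_cases h1 : a x = j
        · have : j ∈ A x := h1 ▸ ha x
          simp [h1, this, markedDelayLaw]
        · by_cases h2 : j ∈ A x <;> simp [h1, h2, markedDelayLaw]
    rw [Finset.sum_congr rfl fun x _ => hx x, Finset.sum_add_distrib, ← Finset.sum_mul,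
      ← Finset.sum_mul, ← ENNReal.ofReal_sum_of_nonneg fun x _ => by split_ifs <;> simp [hw],
      ← ENNReal.ofReal_sum_of_nonneg fun x _ => by split_ifs <;> simp [hw], hmark, hlow,
      ENNReal.ofReal_mul hπ0, ENNReal.ofReal_mul hπ0, hτ, twoPointLaw, Measure.add_apply,
      Measure.smul_apply, Measure.smul_apply, smul_eq_mul, smul_eq_mul]
    ring
  have h2 : ∀ s, MeasurableSet s → η ((fun q => q.2 j) ⁻¹' s ∩ {q | j ∈ q.1}ᶜ) =
      ENNReal.ofReal (1 - π j) * τ s := fun s hs => by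
    have e := coupledLaw_apply (w := w) (A := A) (a := a) (z := z) (c := c) hp j {B | j ∉ B} hs
    refine e.trans ?_
    have hx : ∀ x, ENNReal.ofReal (w x) * (({B | j ∉ B} : Set (Finset (Fin m))).indicator 1 (A x) *
        markedDelayLaw z c p (A x) (a x) j s) =
        ENNReal.ofReal (if j ∈ A x then 0 else w x) * τ s := fun x => by
      by_cases h2 : j ∈ A x
      · simp [h2]
      · have h1 : a x ≠ j := fun h => h2 (h ▸ ha x)
        simp [h1, h2, markedDelayLaw, hτ]
    rw [Finset.sum_congr rfl fun x _ => hx x, ← Finset.sum_mul,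
      ← ENNReal.ofReal_sum_of_nonneg fun x _ => by split_ifs <;> simp [hw], hout]
  have hpp : ENNReal.ofReal (π j) + ENNReal.ofReal (1 - π j) = 1 := by
    rw [← ENNReal.ofReal_add hπ0 (by linarith)]
    simp
  obtain ⟨h3, h4⟩ := indepFun_prop_of_measure_inter hB hpp measure_univ h1 h2
  refine ⟨?_, ?_, h4⟩
  · have mj : Measurable fun q : Finset (Fin m) × (Fin m → ℝ) => q.2 j := by fun_prop
    ext s hs
    rw [Measure.map_apply mj hs, h3 s hs]
  · have := h1 _ MeasurableSet.univ
    rw [Set.preimage_univ, Set.univ_inter, measure_univ, mul_one] at this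
    rw [measureReal_def, this, ENNReal.toReal_ofReal hπ0]

lemma ae_coupledLaw {P : Finset (Fin m) × (Fin m → ℝ) → Prop} (hP : MeasurableSet {q | P q})
    (hp : ∀ j, p j ∈ Set.Icc (0 : ℝ) 1)
    (h : ∀ x, ∀ᵐ q ∂(Measure.pi (markedDelayLaw z c p (A x) (a x))), P (A x, q)) :
    ∀ᵐ q ∂(coupledLaw w A a z c p), P q := by
  have := isProbabilityMeasure_markedDelayLaw (z := z) (c := c) hp
  rw [coupledLaw, ae_iff, Measure.finsetSum_apply]
  refine Finset.sum_eq_zero fun x _ => ae_iff.1 (Measure.ae_smul_measure ?_ _)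
  rw [Measure.dirac_prod, ae_map_iff (by fun_prop) hP]
  exact h x

/-- The marked node has the upper value and the other selected nodes the lower value, so the largest
selected delay is the upper value of the marked node. -/
lemma ae_maxDelay_eq (hp : ∀ j, p j ∈ Set.Icc (0 : ℝ) 1) (hc : ∀ j, 0 ≤ c j)
    {B : Finset (Fin m)} {b : Fin m} (hb : b ∈ B) :
    ∀ᵐ q ∂(Measure.pi (markedDelayLaw z c p B b)), maxDelay B q = z + c b := by
  have := isProbabilityMeasure_markedDelayLaw (z := z) (c := c) hp
  have hj : ∀ j, ∀ᵐ q ∂(Measure.pi (markedDelayLaw z c p B b)),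
      (j = b → q j = z + c j) ∧ (j ∈ B → j ≠ b → q j = z - c j) := fun j => by
    have hq := (measurePreserving_eval (markedDelayLaw z c p B b) j).quasiMeasurePreserving
    have h : ∀ᵐ y ∂(markedDelayLaw z c p B b j),
        (j = b → y = z + c j) ∧ (j ∈ B → j ≠ b → y = z - c j) := by
      unfold markedDelayLaw
      split_ifs with h1 h2
      · rw [ae_dirac_eq]
        exact ⟨fun _ => rfl, fun _ h => absurd h1.symm h⟩
      · rw [ae_dirac_eq]
        exact ⟨fun h => absurd h.symm h1, fun _ _ => rfl⟩
      · exact Filter.Eventually.of_forall fun y => ⟨fun h => absurd h.symm h1, fun h => absurd h h2⟩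
    exact hq.ae h
  filter_upwards [ae_all_iff.2 hj] with q hq
  rw [maxDelay_eq ⟨b, hb⟩]
  refine le_antisymm (Finset.sup'_le _ _ fun j hjB => ?_) ?_
  · by_cases h : j = b
    · rw [(hq j).1 h, h]
    · rw [(hq j).2 hjB h]
      linarith [hc j, hc b]
  · rw [← (hq b).1 rfl]
    exact Finset.le_sup' q hb

lemma integral_maxDelay_coupledLaw (hw : ∀ x, 0 ≤ w x) (hw1 : ∑ x, w x = 1)
    (hp : ∀ j, p j ∈ Set.Icc (0 : ℝ) 1) (hc : ∀ j, 0 ≤ c j) (ha : ∀ x, a x ∈ A x)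
    (hmark : ∀ j, ∑ x, (if a x = j then w x else 0) = π j * p j) :
    ∫ q, maxDelay q.1 q.2 ∂(coupledLaw w A a z c p) = z + ∑ j, π j * p j * c j := by
  have := isProbabilityMeasure_markedDelayLaw (z := z) (c := c) hp
  have hae : ∀ x, (fun q => maxDelay (A x) q) =ᵐ[Measure.pi (markedDelayLaw z c p (A x) (a x))]
      fun _ => z + c (a x) := fun x => ae_maxDelay_eq hp hc (ha x)
  have mA : ∀ B : Finset (Fin m), Measurable fun q : Fin m → ℝ => (B, q) := fun B => by fun_prop
  have hint : ∀ x, Integrable (fun q => maxDelay q.1 q.2)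
      ((Measure.dirac (A x)).prod (Measure.pi (markedDelayLaw z c p (A x) (a x)))) := fun x => by
    rw [Measure.dirac_prod, integrable_map_measure measurable_maxDelay.aestronglyMeasurable
      (mA _).aemeasurable]
    exact (integrable_const (z + c (a x))).congr (hae x).symm
  have hval : ∀ x, ∫ q, maxDelay q.1 q.2
      ∂((Measure.dirac (A x)).prod (Measure.pi (markedDelayLaw z c p (A x) (a x)))) =
      z + c (a x) := fun x => by
    rw [Measure.dirac_prod, integral_map (mA _).aemeasurable
      measurable_maxDelay.aestronglyMeasurable, integral_congr_ae (hae x)]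
    simp
  rw [coupledLaw, integral_finsetSum_measure fun x _ => (hint x).smul_measure (by simp)]
  simp_rw [integral_smul_measure, hval, ENNReal.toReal_ofReal (hw _), smul_eq_mul, mul_add,
    Finset.sum_add_distrib, ← Finset.sum_mul, hw1, one_mul, ← hmark, Finset.sum_mul]
  rw [Finset.sum_comm]
  simp [ite_mul]

end Coupling

section SymmetricTwoPoint

/-- Half the distance between the two points of the law of mean `e` and variance `v` that is
carried by two points at equal distance from `z`. -/
noncomputable def halfWidth (e v z : ℝ) : ℝ := Real.sqrt ((e - z) ^ 2 + v)

variable {e v z : ℝ}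

lemma halfWidth_mul_upperProb (hv : 0 ≤ v) :
    halfWidth e v z * (2 * upperProb e v z - 1) = e - z := by
  rcases (Real.sqrt_nonneg ((e - z) ^ 2 + v)).eq_or_lt with h | h
  · have h0 := (Real.sqrt_eq_zero (by positivity)).1 h.symm
    have : e - z = 0 := by nlinarith [sq_nonneg (e - z)]
    rw [halfWidth, ← h, this, zero_mul]
  · rw [halfWidth, upperProb]
    field_simp
    ring

lemma integral_symmetricTwoPoint (hv : 0 ≤ v) :
    ∫ x, x ∂(twoPointLaw (upperProb e v z) (z + halfWidth e v z) (z - halfWidth e v z)) = e := by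
  rw [integral_twoPointLaw (upperProb_mem_Icc hv)]
  linear_combination halfWidth_mul_upperProb (e := e) (z := z) hv

lemma variance_symmetricTwoPoint (hv : 0 ≤ v) :
    variance (fun x => x)
      (twoPointLaw (upperProb e v z) (z + halfWidth e v z) (z - halfWidth e v z)) = v := by
  rw [variance_twoPointLaw (upperProb_mem_Icc hv) _ _ (f := fun x => x) measurable_id]
  have h1 := halfWidth_mul_upperProb (e := e) (z := z) hv
  have h2 : halfWidth e v z ^ 2 = (e - z) ^ 2 + v := Real.sq_sqrt (by positivity)
  have h3 := congrArg (· ^ 2) h1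
  linear_combination h2 - h3

end SymmetricTwoPoint

namespace StorageSystem

variable {r m : ℕ} {sys : StorageSystem r m}

/-- Tightness for the given selection probabilities, means and variances. -/
theorem exists_jointLaw_eq (hstable : ∀ j, sys.intensity j < 1) {i : Fin r}
    (hrate : 0 < sys.rate i) (hcache : sys.d i < sys.k i) :
    ∃ η : Measure (Finset (Fin m) × (Fin m → ℝ)), IsProbabilityMeasure η ∧
      (∀ᵐ p ∂η, p.1 ⊆ sys.placement i ∧ p.1.card = sys.k i - sys.d i) ∧
      (∀ j, η.real {p | j ∈ p.1} = sys.selProb i j) ∧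
      (∀ j, IndepFun (fun p => p.2 j) (fun p => j ∈ p.1) η) ∧
      (∀ j, MemLp (fun p => p.2 j) 2 η ∧
        ∫ p, p.2 j ∂η = sys.delayMean j ∧
        variance (fun p => p.2 j) η = sys.delayVar j) ∧
      Integrable (fun p => maxDelay p.1 p.2) η ∧
      ∫ p, maxDelay p.1 p.2 ∂η =
        latencyBound (sys.placement i) (sys.selProb i) sys.delayMean sys.delayVar := by
  have hv := delayVar_nonneg hstable
  rcases (by omega : sys.k i - sys.d i = 1 ∨ 2 ≤ sys.k i - sys.d i) with hK | hK
  · -- a single selected node: every independent coupling attains the bound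
    set τ : Fin m → Measure ℝ := fun j =>
      twoPointLaw (upperProb (sys.delayMean j) (sys.delayVar j) 0)
        (0 + halfWidth (sys.delayMean j) (sys.delayVar j) 0)
        (0 - halfWidth (sys.delayMean j) (sys.delayVar j) 0)
    have hτ : ∀ j, IsProbabilityMeasure (τ j) := fun j =>
      isProbabilityMeasure_twoPointLaw (upperProb_mem_Icc (hv j)) _ _
    have hid : ∀ j, IdentDistrib (fun q : Fin m → ℝ => q j) (fun x => x) (Measure.pi τ) (τ j) :=
      fun j => ⟨(measurable_pi_apply j).aemeasurable, aemeasurable_id, by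
        rw [show (fun q : Fin m → ℝ => q j) = Function.eval j from rfl,
          (measurePreserving_eval τ j).map_eq]
        exact Measure.map_id.symm⟩
    have hLp : ∀ j, MemLp (fun q : Fin m → ℝ => q j) 2 (Measure.pi τ) := fun j =>
      (hid j).symm.memLp_snd (memLp_two_twoPointLaw _ _ measurable_id)
    have hmean : ∀ j, ∫ q, q j ∂(Measure.pi τ) = sys.delayMean j := fun j => by
      rw [(hid j).integral_eq, integral_symmetricTwoPoint (hv j)]
    have hvar : ∀ j, variance (fun q => q j) (Measure.pi τ) = sys.delayVar j := fun j => by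
      rw [(hid j).variance_eq, variance_symmetricTwoPoint (hv j)]
    have hmax := integral_maxDelay_dispatchProd (sys := sys) (i := i) hLp
    refine ⟨sys.dispatchProd i (Measure.pi τ), inferInstance, ae_dispatchProd,
      dispatchProd_real_mem, indepFun_dispatchProd, fun j => ⟨?_, ?_, ?_⟩, hmax.1, ?_⟩
    · exact (identDistrib_dispatchProd j).symm.memLp_snd (hLp j)
    · rw [(identDistrib_dispatchProd j).integral_eq, hmean]
    · rw [(identDistrib_dispatchProd j).variance_eq, hvar]
    · rw [hmax.2, sum_integral_maxDelay_eq_of_eq_one hK]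
      simp only [hmean, hvar]
  have hsum : ∑ j ∈ sys.placement i, sys.selProb i j = ((sys.k i - sys.d i : ℕ) : ℝ) :=
    sys.sum_selProb i
  obtain ⟨z, hz⟩ := exists_isMinOn_boundObjective (S := sys.placement i) (e := sys.delayMean)
    (sys.selProb_nonneg i) hv (by rw [hsum]; exact_mod_cast hK)
  set c : Fin m → ℝ := fun j => halfWidth (sys.delayMean j) (sys.delayVar j) z with hcdef
  set p : Fin m → ℝ := fun j => upperProb (sys.delayMean j) (sys.delayVar j) z with hpdef
  have hp : ∀ j, p j ∈ Set.Icc (0 : ℝ) 1 := fun j => upperProb_mem_Icc (hv j)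
  have hc : ∀ j, 0 ≤ c j := fun j => Real.sqrt_nonneg _
  have hone : ∑ j, sys.selProb i j * p j = 1 := by
    rw [← sum_mul_upperProb_eq_one (sys.selProb_nonneg i)
      (fun j hj => delayVar_pos hstable hrate hj) hz]
    exact (Finset.sum_subset (Finset.subset_univ _) fun j _ hj => by
      rw [sys.selProb_eq_zero hj, zero_mul]).symm
  obtain ⟨w, A, a, hw, hw1, ha, hcard, hmark, hsel⟩ := exists_marked_selection hK
    (fun j => mul_nonneg (sys.selProb_nonneg i j) (hp j).1)
    (fun j => mul_le_of_le_one_right (sys.selProb_nonneg i j) (hp j).2)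
    (sys.selProb_le_one i) hone (sys.sum_selProb_univ i)
  have hη := isProbabilityMeasure_coupledLaw (A := A) (a := a) (z := z) (c := c) hw hw1 hp
  have hdelay := coupledLaw_delay (z := z) (c := c) hw hw1 hp ha hmark hsel
  set η := coupledLaw w A a z c p
  have hid : ∀ j, IdentDistrib (fun q => q.2 j) (fun x => x) η
      (twoPointLaw (p j) (z + c j) (z - c j)) := fun j =>
    ⟨(by fun_prop : Measurable fun q : Finset (Fin m) × (Fin m → ℝ) => q.2 j).aemeasurable,
      aemeasurable_id, by rw [(hdelay j).1]; exact Measure.map_id.symm⟩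
  have hLp : ∀ j, MemLp (fun q => q.2 j) 2 η := fun j =>
    (hid j).symm.memLp_snd (memLp_two_twoPointLaw _ _ measurable_id)
  refine ⟨η, hη, ?_, fun j => (hdelay j).2.1, fun j => (hdelay j).2.2, fun j => ⟨hLp j, ?_, ?_⟩,
    integrable_maxDelay measurable_fst measurable_snd fun j => (hLp j).integrable (by norm_num), ?_⟩
  · have h1 : ∀ᵐ q ∂η, q.1.card = sys.k i - sys.d i :=
      ae_coupledLaw (measurable_fst (MeasurableSet.of_discrete
        (s := {B : Finset (Fin m) | B.card = sys.k i - sys.d i}))) hp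
        fun x => Filter.Eventually.of_forall fun _ => hcard x
    have h2 : ∀ᵐ q ∂η, ∀ j, j ∉ sys.placement i → j ∉ q.1 := by
      rw [ae_all_iff]
      intro j
      by_cases hj : j ∈ sys.placement i
      · exact Filter.Eventually.of_forall fun _ h => absurd hj h
      · have h3 : η.real {q | j ∈ q.1} = 0 := by rw [(hdelay j).2.1, sys.selProb_eq_zero hj]
        rw [measureReal_eq_zero_iff] at h3
        filter_upwards [measure_eq_zero_iff_ae_notMem.1 h3] with q hq _ using hq
    filter_upwards [h1, h2] with q h3 h4
    exact ⟨fun j hj => by_contra fun h => h4 j h hj, h3⟩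
  · rw [(hid j).integral_eq, integral_symmetricTwoPoint (hv j)]
  · rw [(hid j).variance_eq, variance_symmetricTwoPoint (hv j)]
  · rw [integral_maxDelay_coupledLaw hw hw1 hp hc ha hmark,
      latencyBound_eq_of_isMinOn hz, boundObjective_eq]
    congr 1
    symm
    refine (Finset.sum_subset (Finset.subset_univ _) fun j _ hj => by
      rw [sys.selProb_eq_zero hj, zero_mul]).trans (Finset.sum_congr rfl fun j _ => ?_)
    have h := halfWidth_mul_upperProb (e := sys.delayMean j) (z := z) (hv j)
    change sys.selProb i j * (((sys.delayMean j - z) + c j) / 2) = sys.selProb i j * p j * c j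
    linear_combination -(sys.selProb i j / 2) * h

end StorageSystem

theorem lemma1 {r m : ℕ} (sys : StorageSystem r m)
    (hstable : ∀ j, sys.intensity j < 1)
    (i : Fin r) (hrate : 0 < sys.rate i) (hcache : sys.d i < sys.k i) :
    -- the bound is a genuine infimum, attained when at least two nodes are contacted
    BddBelow (Set.range (boundObjective (sys.placement i) (sys.selProb i)
      sys.delayMean sys.delayVar)) ∧
    (2 ≤ sys.k i - sys.d i →
      ∃ z₀ : ℝ, IsMinOn (boundObjective (sys.placement i) (sys.selProb i)
        sys.delayMean sys.delayVar) Set.univ z₀) ∧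
    -- in steady state, mean and variance of the delays, and the bound on the mean latency
    (∀ (Ω : Type*) [MeasurableSpace Ω] (P : Measure Ω) [IsProbabilityMeasure P]
      (st : sys.SteadyState P) (n : ℕ),
      (∀ j, MemLp (fun ω => st.delay n ω j) 2 P ∧
        ∫ ω, st.delay n ω j ∂P = sys.delayMean j ∧
        variance (fun ω => st.delay n ω j) P = sys.delayVar j) ∧
      Integrable (st.latency n) (ProbabilityTheory.cond P {ω | st.file n ω = i}) ∧
      ∫ ω, st.latency n ω ∂(ProbabilityTheory.cond P {ω | st.file n ω = i}) ≤
        latencyBound (sys.placement i) (sys.selProb i) sys.delayMean sys.delayVar) ∧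
    -- tightness, same dispatch law: nonnegative delays independent of the dispatch decision, with
    -- the mean and variance above at any one prescribed node
    (∀ l ∈ sys.placement i, ∃ ν : Measure (Fin m → ℝ), IsProbabilityMeasure ν ∧
      (∀ j, ∀ᵐ q ∂ν, 0 ≤ q j) ∧
      (∀ j, MemLp (fun q => q j) 2 ν) ∧
      ∫ q, q l ∂ν = sys.delayMean l ∧
      variance (fun q => q l) ν = sys.delayVar l ∧
      ∑ A : Finset (Fin m), (sys.dispatch i A).toReal * ∫ q, maxDelay A q ∂ν =
        latencyBound (sys.placement i) (sys.selProb i)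
          (fun j => ∫ q, q j ∂ν) (fun j => variance (fun q => q j) ν)) ∧
    -- tightness, same selection probabilities and same means and variances at all nodes: a joint
    -- law of the selected set and the delays
    (∃ η : Measure (Finset (Fin m) × (Fin m → ℝ)), IsProbabilityMeasure η ∧
      (∀ᵐ p ∂η, p.1 ⊆ sys.placement i ∧ p.1.card = sys.k i - sys.d i) ∧
      (∀ j, η.real {p | j ∈ p.1} = sys.selProb i j) ∧
      (∀ j, IndepFun (fun p => p.2 j) (fun p => j ∈ p.1) η) ∧
      (∀ j, MemLp (fun p => p.2 j) 2 η ∧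
        ∫ p, p.2 j ∂η = sys.delayMean j ∧
        variance (fun p => p.2 j) η = sys.delayVar j) ∧
      Integrable (fun p => maxDelay p.1 p.2) η ∧
      ∫ p, maxDelay p.1 p.2 ∂η =
        latencyBound (sys.placement i) (sys.selProb i) sys.delayMean sys.delayVar) := by
  have hv := StorageSystem.delayVar_nonneg hstable
  have hsum := sys.sum_selProb i
  refine ⟨bddBelow_boundObjective (sys.selProb_nonneg i) hv ?_, fun hK =>
    exists_isMinOn_boundObjective (sys.selProb_nonneg i) hv ?_, ?_,
    fun l _ => StorageSystem.exists_delayLaw_eq hstable hcache l,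
    StorageSystem.exists_jointLaw_eq hstable hrate hcache⟩
  · rw [hsum]
    exact_mod_cast (by omega : 1 ≤ sys.k i - sys.d i)
  · rw [hsum]
    exact_mod_cast hK
  · intro Ω _ P _ st n
    exact ⟨st.delay_moments (StorageSystem.totalRate_pos hrate) hstable n,
      st.latency_le hstable hrate hcache n⟩
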